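/- **Setting.** Let $v:(0,\infty)\to\mathbb R\cup\{+\infty\}$ be a pair potential with a hard core of radius $r_{\rm hc}>0$: $v=+\infty$ on $(0,r_{\rm hc}]$ and $v$ is real-valued and $C^2$ on $(r_{\rm hc},\infty)$. Assume that there are $r_{\rm hc}<z_{\min}<z_{\max}<2z_{\min}$, $\alpha_1,\alpha_2>0$ and $s>2$ such that (i) $z_{\max}$ is the unique minimizer of $v$, $v(z_{\max})<0$, $v$ is decreasing on $(0,z_{\max})$, and increasing and non-positive on $(z_{\max},\infty)$ (monotonicity in the weak sense); (ii) $v(z)\ge-\alpha_1z^{-s}$ for all $z>0$, and $v(z)+v(z_{\max})-2\alpha_1\sum_{n\ge2}(nz)^{-s}>0$ for all $0<z<z_{\min}$; (iii) $v''$ is decreasing on $[z_{\min},z_{\max}]$, and increasing and non-positive on $[2z_{\min},\infty)$; (iv) $v''(z)\ge-\alpha_2z^{-s-2}$ for all $z>r_{\rm hc}$, and $v''(z_{\max})+\sum_{n\ge2}n^2v''(nz_{\min})>0$. Let $m\in\{1,2,\dots\}\cup\{\infty\}$. For $\beta,p>0$ and $N\ge 1$, let $\mathbb Q_N^{(\beta)}$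 be the probability measure on $\mathbb R_+^{N-1}$, $\mathbb R_+=(0,\infty)$, with density proportional to $e^{-\beta\mathcal E_N}$, where $$\mathcal E_N(z_1,\dots,z_{N-1})=\sum_{1\le i<j\le N,\ j-i\le m}v(z_i+\cdots+z_{j-1})+p\sum_{j=1}^{N-1}z_j .$$ The bulk Gibbs measure $\mu_\beta$ (which also depends on $p$ and $m$) is the shift-invariant probability measure on $\mathbb R_+^{\mathbb Z}$ such that, for all $k\in\mathbb N$, all bounded continuous $f$ of $k$ variables and all integer sequences $i_N$ with $i_N\to\infty$ and $N-i_N\to\infty$, $$\lim_{N\to\infty}\int f(z_{i_N+1},\dots,z_{i_N+k})\,d\mathbb Q_N^{(\beta)}=\int f(z_1,\dots,z_k)\,d\mu_\beta .$$ For $f:\mathbb R_+^k\to\mathbb R$ write $f_i((z_j)_{j\in\mathbb Z})=f(z_i,\dots,z_{i+k-1})$ and $\|f\|_\infty=\sup_{\mathbb R_+^k}|f|$. **Theorem.** There exist $c,C>0$, depending on $v$ and $m$ but not on $\beta$ and $p$, such that for all $\beta,p>0$ the measure $\mu_\beta$ exists and is unique, and for all integers $k\ge1$, all bounded measurable $f,g:\mathbb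 R_+^k\to\mathbb R$ and all integers $n\ge k$, $$\bigl|\mu_\beta(f_0g_n)-\mu_\beta(f_0)\mu_\beta(g_n)\bigr|\le\min_{q\in\mathbb N:\,1\le q\le n/k}\Bigl((1-e^{-c\beta})^q+e^{c\beta}\bigl(e^{C\beta(q/n)^{s-2}}-1\bigr)\Bigr)\|f\|_\infty\|g\|_\infty .$$ If $m$ is finite, $m\ge2$ and $k=m-1$, then moreover, with the same $c$ and for all integers $n\ge0$, $$\bigl|\mu_\beta(f_0g_n)-\mu_\beta(f_0)\mu_\beta(g_n)\bigr|\le(1-e^{-c\beta})^{\lfloor n/k\rfloor}\,\|f\|_\infty\|g\|_\infty .$$ -/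

import Mathlib

open MeasureTheory Filter Topology Set

noncomputable section

namespace LJChain

/-- The real-valued version of the pair potential; it is only used where `v` is finite,
i.e. on `(r_hc, ∞)`. -/
def realPart (v : ℝ → EReal) (r : ℝ) : ℝ := (v r).toReal

/-- The standing assumption on the pair potential `v : (0, ∞) → ℝ ∪ {+∞}` (values of `v` at
non-positive arguments play no role): a hard core of radius `rhc`, and a Lennard-Jones type
shape with decay exponent `s > 2`. Sums over `n ≥ 2` are written with the index `n + 2`. -/
structure IsLennardJonesType (v : ℝ → EReal) (rhc zmin zmax α₁ α₂ s : ℝ) : Prop where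
  rhc_nonneg : 0 ≤ rhc
  eq_top : ∀ r, 0 < r → r ≤ rhc → v r = ⊤
  ne_top : ∀ r, rhc < r → v r ≠ ⊤
  ne_bot : ∀ r, rhc < r → v r ≠ ⊥
  contDiffOn : ContDiffOn ℝ 2 (realPart v) (Ioi rhc)
  rhc_lt_zmin : rhc < zmin
  zmin_lt_zmax : zmin < zmax
  zmax_lt : zmax < 2 * zmin
  α₁_pos : 0 < α₁
  α₂_pos : 0 < α₂
  two_lt_s : 2 < s
  unique_min : ∀ r, 0 < r → r ≠ zmax → v zmax < v r
  min_neg : v zmax < 0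
  antitoneOn : AntitoneOn v (Ioo 0 zmax)
  monotoneOn : MonotoneOn v (Ioi zmax)
  nonpos : ∀ r, zmax < r → v r ≤ 0
  lower_bound : ∀ z, 0 < z → ((-α₁ * z ^ (-s) : ℝ) : EReal) ≤ v z
  repulsion : ∀ z, 0 < z → z < zmin →
    0 < v z + v zmax - ((2 * α₁ * ∑' n : ℕ, (((n : ℝ) + 2) * z) ^ (-s) : ℝ) : EReal)
  deriv2_antitoneOn : AntitoneOn (deriv^[2] (realPart v)) (Icc zmin zmax)
  deriv2_monotoneOn : MonotoneOn (deriv^[2] (realPart v)) (Ici (2 * zmin))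
  deriv2_nonpos : ∀ z, 2 * zmin ≤ z → deriv^[2] (realPart v) z ≤ 0
  deriv2_lower_bound : ∀ z, rhc < z → -α₂ * z ^ (-s - 2) ≤ deriv^[2] (realPart v) z
  deriv2_convexity : 0 < deriv^[2] (realPart v) zmax +
    ∑' n : ℕ, ((n : ℝ) + 2) ^ 2 * deriv^[2] (realPart v) (((n : ℝ) + 2) * zmin)

/-- The Gibbs energy at pressure `p` of a chain with `M` spacings (that is `M + 1` particles).
A pair of particles corresponds to the nonempty interval `{i, …, j}` of the spacings between
them, and the pair interacts if this interval has at most `m` elements. -/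
def energy (v : ℝ → EReal) (m : ℕ∞) (p : ℝ) {M : ℕ} (z : Fin M → ℝ) : EReal :=
  (∑ i : Fin M, ∑ j ∈ Finset.Ici i,
    if ((Finset.Icc i j).card : ℕ∞) ≤ m then v (∑ l ∈ Finset.Icc i j, z l) else 0)
  + ((p * ∑ i : Fin M, z i : ℝ) : EReal)

/-- The positive orthant `ℝ₊ᵏ`. -/
def posOrthant (k : ℕ) : Set (Fin k → ℝ) := {x | ∀ i, 0 < x i}

/-- The unnormalised Gibbs measure `exp (-β E) dz` on the positive orthant. -/
def gibbsWeight (v : ℝ → EReal) (m : ℕ∞) (p β : ℝ) (M : ℕ) : Measure (Fin M → ℝ) :=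
  (volume.restrict (posOrthant M)).withDensity
    fun z => EReal.exp (-((β : EReal) * energy v m p z))

/-- The finite-volume Gibbs measure of the chain with `M` spacings; the total mass of
`gibbsWeight` is the partition function. -/
def finiteGibbs (v : ℝ → EReal) (m : ℕ∞) (p β : ℝ) (M : ℕ) : Measure (Fin M → ℝ) :=
  (gibbsWeight v m p β M univ)⁻¹ • gibbsWeight v m p β M

/-- The `k` consecutive spacings of a finite chain that start at the index `i` (counted from
`0`); entries outside the chain are set to `0`. -/
def finWindow {M : ℕ} (k i : ℕ) (z : Fin M → ℝ) : Fin k → ℝ :=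
  fun l => if h : i + (l : ℕ) < M then z ⟨i + l, h⟩ else 0

/-- The `k` consecutive spacings `(z_i, …, z_{i+k-1})` of a bi-infinite chain. -/
def window (k : ℕ) (i : ℤ) (z : ℤ → ℝ) : Fin k → ℝ := fun l => z (i + (l : ℤ))

/-- `μ` is the bulk Gibbs measure on `ℝ₊^ℤ`: the thermodynamic limit of the finite-volume Gibbs
measures seen around sites `i_M` whose distance to both ends of the chain tends to infinity.
The limit is the same for every position `a` of the window in the bi-infinite chain, so the
shift-invariance of `μ` is included. -/
structure IsBulkGibbsMeasure (v : ℝ → EReal) (m : ℕ∞) (p β : ℝ) (μ : Measure (ℤ → ℝ)) :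
    Prop where
  isProbabilityMeasure : IsProbabilityMeasure μ
  ae_pos : ∀ᵐ z ∂μ, ∀ j, 0 < z j
  tendsto : ∀ (k : ℕ) (f : BoundedContinuousFunction (Fin k → ℝ) ℝ) (a : ℤ) (i : ℕ → ℕ),
    Tendsto i atTop atTop → Tendsto (fun M : ℕ => (M : ℤ) - (i M : ℤ)) atTop atTop →
    Tendsto (fun M : ℕ => ∫ z, f (finWindow k (i M) z) ∂(finiteGibbs v m p β M)) atTop
      (𝓝 (∫ z, f (window k a z) ∂μ))

/-- `f : ℝ₊ᵏ → ℝ` is bounded. -/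
def IsBoundedFun {k : ℕ} (f : (Fin k → ℝ) → ℝ) : Prop :=
  BddAbove (range fun x : posOrthant k => |f x|)

/-- The supremum norm of a function on `ℝ₊ᵏ`. -/
def supNorm {k : ℕ} (f : (Fin k → ℝ) → ℝ) : ℝ := ⨆ x : posOrthant k, |f x|

/-- The covariance `μ(f_0 g_n) - μ(f_0) μ(g_n)`, with `f_i(z) = f(z_i, …, z_{i+k-1})`. -/
def correlation (μ : Measure (ℤ → ℝ)) {k : ℕ} (f g : (Fin k → ℝ) → ℝ) (n : ℕ) : ℝ :=
  (∫ z, f (window k 0 z) * g (window k n z) ∂μ)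
    - (∫ z, f (window k 0 z) ∂μ) * ∫ z, g (window k n z) ∂μ

end LJChain

end

/-
Because of the hard core, interactions through `n` spacings are `O(n ^ (-s))` with `s > 2`, so
they perturb an i.i.d. chain of spacings by a Hamiltonian for which the total interaction across a
block of `L` spacings is at most `κ(L) = O(L ^ (2 - s))`, uniformly in the volume. Condition on
everything to the right of a site. Up to an error of order `κ(L)`, only the first `L` spacings of
the condition matter for what lies beyond them; and two conditions that are cut at the same particle
give laws that share the mass `exp (-4K)`, where `K = κ(0)`. Each block of `L` spacings therefore
contracts the oscillation of conditional expectations by the Doeblin factor `1 - exp (-4K)`, up to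
the error coming from `κ(L)`. Iterating over `q` blocks bounds covariances uniformly in the volume;
the same estimate shows that local expectations are Cauchy in the volume, and the density bound on
single spacings gives tightness, hence the bulk measure. If `m = k + 1`, then `κ(k) = 0`.
-/

noncomputable section

namespace LJChain

open ProbabilityTheory

/-- A bounded measurable real function; the observables and the potentials of Gibbs measures
below are of this kind, so that all their integrals exist. -/
structure BddMeasurable {Ω : Type*} [MeasurableSpace Ω] (f : Ω → ℝ) : Prop where
  measurable : Measurable f
  exists_abs_le : ∃ M : ℝ, ∀ ω, |f ω| ≤ M

namespace BddMeasurable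

variable {Ω Ω' : Type*} [MeasurableSpace Ω] [MeasurableSpace Ω'] {f g : Ω → ℝ}

lemma comp (hf : BddMeasurable f) {T : Ω' → Ω} (hT : Measurable T) :
    BddMeasurable fun x => f (T x) :=
  ⟨hf.measurable.comp hT, hf.exists_abs_le.imp fun _ hM x => hM (T x)⟩

lemma const (c : ℝ) : BddMeasurable fun _ : Ω => c :=
  ⟨measurable_const, |c|, fun _ => le_rfl⟩

lemma add (hf : BddMeasurable f) (hg : BddMeasurable g) : BddMeasurable fun x => f x + g x := by
  obtain ⟨M, hM⟩ := hf.exists_abs_le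
  obtain ⟨N, hN⟩ := hg.exists_abs_le
  exact ⟨hf.measurable.add hg.measurable, M + N,
    fun x => (abs_add_le _ _).trans (add_le_add (hM x) (hN x))⟩

lemma mul (hf : BddMeasurable f) (hg : BddMeasurable g) : BddMeasurable fun x => f x * g x := by
  obtain ⟨M, hM⟩ := hf.exists_abs_le
  obtain ⟨N, hN⟩ := hg.exists_abs_le
  refine ⟨hf.measurable.mul hg.measurable, M * N, fun x => ?_⟩
  rw [abs_mul]
  exact mul_le_mul (hM x) (hN x) (abs_nonneg _) ((abs_nonneg _).trans (hM x))

lemma neg (hf : BddMeasurable f) : BddMeasurable fun x => -f x := by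
  simpa only [neg_one_mul] using (const (-1)).mul hf

lemma sub (hf : BddMeasurable f) (hg : BddMeasurable g) : BddMeasurable fun x => f x - g x := by
  simpa only [sub_eq_add_neg] using hf.add hg.neg

lemma sum {ι : Type*} (s : Finset ι) {F : ι → Ω → ℝ} (hF : ∀ i ∈ s, BddMeasurable (F i)) :
    BddMeasurable fun x => ∑ i ∈ s, F i x := by
  choose! M hM using fun i hi => (hF i hi).exists_abs_le
  exact ⟨Finset.measurable_sum s fun i hi => (hF i hi).measurable, ∑ i ∈ s, M i,
    fun x => (Finset.abs_sum_le_sum_abs _ _).trans (Finset.sum_le_sum fun i hi => hM i hi x)⟩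

lemma exp (hf : BddMeasurable f) : BddMeasurable fun x => Real.exp (f x) := by
  obtain ⟨M, hM⟩ := hf.exists_abs_le
  refine ⟨hf.measurable.exp, Real.exp M, fun x => ?_⟩
  rw [Real.abs_exp]
  exact Real.exp_le_exp.2 ((le_abs_self _).trans (hM x))

lemma memLp (hf : BddMeasurable f) (p : ENNReal) (P : Measure Ω) [IsFiniteMeasure P] :
    MemLp f p P := by
  obtain ⟨M, hM⟩ := hf.exists_abs_le
  exact MemLp.of_bound hf.measurable.aestronglyMeasurable M (Eventually.of_forall hM)

lemma integrable (hf : BddMeasurable f) (P : Measure Ω) [IsFiniteMeasure P] : Integrable f P :=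
  memLp_one_iff_integrable.1 (hf.memLp 1 P)

lemma integral_prod_right {F : Ω × Ω' → ℝ} (hF : BddMeasurable F) (P : Measure Ω')
    [IsFiniteMeasure P] : BddMeasurable fun x => ∫ y, F (x, y) ∂P := by
  obtain ⟨M, hM⟩ := hF.exists_abs_le
  exact ⟨hF.measurable.stronglyMeasurable.integral_prod_right'.measurable, M * P.real univ,
    fun x => norm_integral_le_of_norm_le_const (f := fun y => F (x, y))
      (Eventually.of_forall fun y => hM (x, y))⟩

lemma isProbabilityMeasure_tilted (hf : BddMeasurable f) (P : Measure Ω)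
    [IsProbabilityMeasure P] : IsProbabilityMeasure (P.tilted f) :=
  MeasureTheory.isProbabilityMeasure_tilted (hf.exp.integrable P)

lemma integral_comp (hf : BddMeasurable f) {P : Measure Ω'} {P' : Measure Ω} {T : Ω' → Ω}
    (hT : MeasurePreserving T P P') : ∫ x, f (T x) ∂P = ∫ x, f x ∂P' := by
  rw [← hT.map_eq, integral_map hT.aemeasurable hf.measurable.aestronglyMeasurable]

end BddMeasurable

section Integral

lemma exists_forall_mem_Icc_of_abs_sub_le {α : Type*} [Nonempty α] {f : α → ℝ} {D : ℝ}
    (hD : ∀ x y, |f x - f y| ≤ D) : ∃ l, ∀ x, f x ∈ Icc l (l + D) := by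
  obtain ⟨z⟩ := ‹Nonempty α›
  have hbdd : BddBelow (range f) :=
    ⟨f z - D, forall_mem_range.2 fun x => by linarith [(abs_le.1 (hD x z)).1]⟩
  refine ⟨⨅ x, f x, fun x => ⟨ciInf_le hbdd x, ?_⟩⟩
  have : Nonempty α := ⟨z⟩
  have : f x - D ≤ ⨅ y, f y := le_ciInf fun y => by linarith [(abs_le.1 (hD x y)).2]
  linarith

variable {Ω : Type*} [MeasurableSpace Ω]

lemma abs_integral_le_of_abs_le (P : Measure Ω) [IsProbabilityMeasure P] {f : Ω → ℝ} {M : ℝ}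
    (hM : ∀ x, |f x| ≤ M) : |∫ x, f x ∂P| ≤ M := by
  simpa using norm_integral_le_of_norm_le_const (μ := P) (f := f) (Eventually.of_forall hM)

lemma abs_integral_sub_integral_le {Ω' : Type*} [MeasurableSpace Ω'] (P : Measure Ω)
    (P' : Measure Ω') [IsProbabilityMeasure P] [IsProbabilityMeasure P'] {f : Ω → ℝ} {f' : Ω' → ℝ}
    (hf : BddMeasurable f) (hf' : BddMeasurable f') {δ : ℝ} (h : ∀ x x', |f x - f' x'| ≤ δ) :
    |∫ x, f x ∂P - ∫ x, f' x ∂P'| ≤ δ := by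
  have hx' (x' : Ω') : |∫ x, f x ∂P - f' x'| ≤ δ := by
    simpa [integral_sub (hf.integrable P) (integrable_const _)] using
      abs_integral_le_of_abs_le P fun x => h x x'
  simpa [integral_sub (integrable_const _) (hf'.integrable P')] using
    abs_integral_le_of_abs_le P' hx'

lemma covariance_sq_le (P : Measure Ω) [IsProbabilityMeasure P] {f g : Ω → ℝ}
    (hf : MemLp f 2 P) (hg : MemLp g 2 P) :
    (cov[f, g; P]) ^ 2 ≤ Var[f; P] * Var[g; P] := by
  have h_nonneg (t : ℝ) :
      0 ≤ Var[f; P] * (t * t) + 2 * cov[f, g; P] * t + Var[g; P] := by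
    have h := variance_nonneg (t • f + g) P
    rw [variance_add (hf.const_smul t) hg,
      variance_smul, covariance_smul_left] at h
    linarith
  have h := discrim_le_zero h_nonneg
  rw [discrim] at h
  linarith

lemma abs_covariance_le (P : Measure Ω) [IsProbabilityMeasure P] {f g : Ω → ℝ}
    (hf : BddMeasurable f) (hg : BddMeasurable g) {D G : ℝ}
    (hD : ∀ x y, |f x - f y| ≤ 2 * D) (hG : ∀ x, |g x| ≤ G) :
    |cov[f, g; P]| ≤ D * G := by
  obtain ⟨z⟩ := nonempty_of_isProbabilityMeasure P
  have hD0 : 0 ≤ D := by linarith [(abs_nonneg _).trans (hD z z)]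
  have hG0 : 0 ≤ G := (abs_nonneg _).trans (hG z)
  have : Nonempty Ω := ⟨z⟩
  obtain ⟨l, hl⟩ := exists_forall_mem_Icc_of_abs_sub_le hD
  have hf_var : Var[f; P] ≤ D ^ 2 := by
    refine (variance_le_sq_of_bounded (Eventually.of_forall hl)
      hf.measurable.aemeasurable).trans_eq ?_
    ring
  have hg_var : Var[g; P] ≤ G ^ 2 := by
    refine (variance_le_sq_of_bounded
      (Eventually.of_forall fun x => abs_le.1 (hG x)) hg.measurable.aemeasurable).trans_eq ?_
    ring
  refine abs_le_of_sq_le_sq ?_ (by positivity)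
  calc (cov[f, g; P]) ^ 2 ≤ Var[f; P] * Var[g; P] :=
        covariance_sq_le P (hf.memLp 2 P) (hg.memLp 2 P)
    _ ≤ D ^ 2 * G ^ 2 := by gcongr; exact variance_nonneg _ _
    _ = (D * G) ^ 2 := by ring

/-- The part `t • P` common to both measures does not contribute to the difference. -/
lemma integral_sub_integral_le_of_smul_le {P P' : Measure Ω} [IsProbabilityMeasure P]
    [IsProbabilityMeasure P'] {t : ℝ} (ht : 0 ≤ t) (hPP' : ENNReal.ofReal t • P ≤ P') {h : Ω → ℝ}
    (hh : BddMeasurable h) {D : ℝ} (hD : ∀ x y, |h x - h y| ≤ D) :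
    ∫ x, h x ∂P - ∫ x, h x ∂P' ≤ (1 - t) * D := by
  have : Nonempty Ω := nonempty_of_isProbabilityMeasure P
  have ht1 : t ≤ 1 := by
    simpa [ENNReal.ofReal_le_one] using hPP' univ
  obtain ⟨l, hl⟩ := exists_forall_mem_Icc_of_abs_sub_le hD
  have hhl : BddMeasurable fun x => h x - l := hh.sub (.const l)
  have h_int (Q : Measure Ω) [IsProbabilityMeasure Q] :
      ∫ x, h x - l ∂Q = ∫ x, h x ∂Q - l := by
    simp [integral_sub (hh.integrable Q) (integrable_const _)]
  have h_lower : t * ∫ x, h x - l ∂P ≤ ∫ x, h x - l ∂P' := by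
    have := integral_mono_measure hPP' (Eventually.of_forall fun x => sub_nonneg.2 (hl x).1)
      (hhl.integrable P')
    rwa [integral_smul_measure, ENNReal.toReal_ofReal ht, smul_eq_mul] at this
  have h_upper : ∫ x, h x - l ∂P ≤ D := by
    simpa using integral_mono (hhl.integrable P) (integrable_const D)
      fun x => by linarith [(hl x).2]
  rw [h_int] at h_lower h_upper
  rw [h_int] at h_lower
  nlinarith

lemma abs_integral_sub_integral_le_of_smul_le {P P' : Measure Ω} [IsProbabilityMeasure P]
    [IsProbabilityMeasure P'] {t : ℝ} (ht : 0 ≤ t) (hPP' : ENNReal.ofReal t • P ≤ P') {h : Ω → ℝ}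
    (hh : BddMeasurable h) {D : ℝ} (hD : ∀ x y, |h x - h y| ≤ D) :
    |∫ x, h x ∂P - ∫ x, h x ∂P'| ≤ (1 - t) * D := by
  refine abs_le'.2 ⟨integral_sub_integral_le_of_smul_le ht hPP' hh hD, ?_⟩
  have := integral_sub_integral_le_of_smul_le ht hPP' hh.neg (D := D) fun x y => by
    rw [neg_sub_neg, abs_sub_comm]; exact hD x y
  simpa [integral_neg, sub_eq_add_neg, add_comm] using this

end Integral

section Tilted

variable {Ω : Type*} [MeasurableSpace Ω] (P : Measure Ω)

lemma integral_tilted_eq_div (U h : Ω → ℝ) :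
    ∫ x, h x ∂(P.tilted U) = (∫ x, Real.exp (U x) * h x ∂P) / ∫ x, Real.exp (U x) ∂P := by
  simp_rw [integral_tilted, ← integral_div, smul_eq_mul, div_mul_eq_mul_div]

lemma measurePreserving_tilted {Ω' : Type*} [MeasurableSpace Ω'] {P : Measure Ω}
    {P' : Measure Ω'} {T : Ω → Ω'} (hT : MeasurePreserving T P P') {U : Ω' → ℝ}
    (hU : Measurable U) : MeasurePreserving T (P.tilted fun x => U (T x)) (P'.tilted U) := by
  refine ⟨hT.measurable, Measure.ext fun s hs => ?_⟩
  have h_exp : ∫ x, Real.exp (U (T x)) ∂P = ∫ y, Real.exp (U y) ∂P' := by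
    rw [← hT.map_eq, integral_map hT.aemeasurable hU.exp.aestronglyMeasurable]
  rw [Measure.map_apply hT.measurable hs, tilted_apply' _ _ (hT.measurable hs),
    tilted_apply' _ _ hs, h_exp]
  exact hT.setLIntegral_comp_preimage hs
    (ENNReal.measurable_ofReal.comp (hU.exp.div_const _))

variable [IsProbabilityMeasure P] {W : Ω → ℝ} {a c : ℝ}

lemma exp_div_integral_exp_mem_Icc (hW : BddMeasurable W) (ha : ∀ x, |W x - c| ≤ a) (x : Ω) :
    Real.exp (W x) / ∫ y, Real.exp (W y) ∂P ∈ Icc (Real.exp (-(2 * a))) (Real.exp (2 * a)) := by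
  have h_exp (y : Ω) : Real.exp (W y) ∈ Icc (Real.exp (c - a)) (Real.exp (c + a)) := by
    have := abs_le.1 (ha y)
    exact ⟨Real.exp_le_exp.2 (by linarith), Real.exp_le_exp.2 (by linarith)⟩
  have h_pos : 0 < ∫ y, Real.exp (W y) ∂P := integral_exp_pos (hW.exp.integrable P)
  have h_lower : Real.exp (c - a) ≤ ∫ y, Real.exp (W y) ∂P := by
    simpa using integral_mono (integrable_const _) (hW.exp.integrable P) fun y => (h_exp y).1
  have h_upper : ∫ y, Real.exp (W y) ∂P ≤ Real.exp (c + a) := by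
    simpa using integral_mono (hW.exp.integrable P) (integrable_const _) fun y => (h_exp y).2
  constructor
  · rw [le_div_iff₀ h_pos]
    calc _ ≤ Real.exp (-(2 * a)) * Real.exp (c + a) := by gcongr
      _ = Real.exp (c - a) := by rw [← Real.exp_add]; ring_nf
      _ ≤ _ := (h_exp x).1
  · rw [div_le_iff₀ h_pos]
    calc _ ≤ Real.exp (c + a) := (h_exp x).2
      _ = Real.exp (2 * a) * Real.exp (c - a) := by rw [← Real.exp_add]; ring_nf
      _ ≤ _ := by gcongr

lemma exp_smul_le_tilted (hW : BddMeasurable W) (ha : ∀ x, |W x - c| ≤ a) :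
    ENNReal.ofReal (Real.exp (-(2 * a))) • P ≤ P.tilted W := by
  rw [← withDensity_const, Measure.tilted]
  exact withDensity_mono (Eventually.of_forall fun x =>
    ENNReal.ofReal_le_ofReal (exp_div_integral_exp_mem_Icc P hW ha x).1)

lemma tilted_le_exp_smul (hW : BddMeasurable W) (ha : ∀ x, |W x - c| ≤ a) :
    P.tilted W ≤ ENNReal.ofReal (Real.exp (2 * a)) • P := by
  rw [← withDensity_const, Measure.tilted]
  exact withDensity_mono (Eventually.of_forall fun x =>
    ENNReal.ofReal_le_ofReal (exp_div_integral_exp_mem_Icc P hW ha x).2)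

lemma abs_integral_tilted_sub_le {U U' h : Ω → ℝ} (hU : BddMeasurable U) (hU' : BddMeasurable U')
    (ha : ∀ x, |U x - U' x - c| ≤ a) (hh : BddMeasurable h) {D : ℝ}
    (hD : ∀ x y, |h x - h y| ≤ D) :
    |∫ x, h x ∂(P.tilted U) - ∫ x, h x ∂(P.tilted U')| ≤ (1 - Real.exp (-(2 * a))) * D := by
  have := hU.isProbabilityMeasure_tilted P
  have := hU'.isProbabilityMeasure_tilted P
  have h_tilt : (P.tilted U').tilted (fun x => U x - U' x) = P.tilted U := by
    rw [tilted_tilted (hU'.exp.integrable P)]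
    congr with x
    simp
  rw [abs_sub_comm]
  refine abs_integral_sub_integral_le_of_smul_le (Real.exp_pos _).le ?_ hh hD
  rw [← h_tilt]
  exact exp_smul_le_tilted _ (hU.sub hU') ha

end Tilted

section Resampling

variable {ι : Type*} {E : ι → Type*}

lemma piecewise_piecewise_of_subset {R S : Set ι} [∀ i, Decidable (i ∈ R)]
    [∀ i, Decidable (i ∈ S)] (hRS : R ⊆ S) (ω ω' x : ∀ i, E i) :
    S.piecewise (R.piecewise ω ω') x = R.piecewise ω (S.piecewise ω' x) := by
  ext i
  by_cases hi : i ∈ R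
  · simp [hi, hRS hi]
  · by_cases hi' : i ∈ S <;> simp [hi, hi']

variable [∀ i, MeasurableSpace (E i)]

lemma measurable_piecewise_pi (R : Set ι) [∀ i, Decidable (i ∈ R)] :
    Measurable fun p : (∀ i, E i) × (∀ i, E i) => R.piecewise p.1 p.2 := by
  refine measurable_pi_lambda _ fun i => ?_
  by_cases hi : i ∈ R <;> simp only [Set.piecewise, hi, if_true, if_false] <;> fun_prop

lemma measurable_piecewise_left (R : Set ι) [∀ i, Decidable (i ∈ R)] (x : ∀ i, E i) :
    Measurable fun ω : ∀ i, E i => R.piecewise ω x :=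
  (measurable_piecewise_pi R).comp measurable_prodMk_right

variable (ν : ∀ i, Measure (E i)) (R : Set ι) [∀ i, Decidable (i ∈ R)]

/-- The expectation of `f` under the Gibbs measure `(⨂ ν).tilted U` conditioned on the
configuration off `R` being `x`. As a function of `x` it is the conditional expectation given the
coordinates off `R`, in the regular version provided by the product structure. -/
def gibbsCondExp (U f : (∀ i, E i) → ℝ) (x : ∀ i, E i) : ℝ :=
  ∫ ω, f (R.piecewise ω x) ∂((Measure.infinitePi ν).tilted fun ω => U (R.piecewise ω x))

variable {U f : (∀ i, E i) → ℝ}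

lemma gibbsCondExp_piecewise (ω x : ∀ i, E i) :
    gibbsCondExp ν R U f (R.piecewise ω x) = gibbsCondExp ν R U f x := by
  have h_idem (ω' : ∀ i, E i) : R.piecewise ω' (R.piecewise ω x) = R.piecewise ω' x := by
    ext i
    by_cases hi : i ∈ R <;> simp [hi]
  simp only [gibbsCondExp, h_idem]

lemma gibbsCondExp_mul_of_dependsOn_compl {g : (∀ i, E i) → ℝ} (hg : DependsOn g Rᶜ)
    (x : ∀ i, E i) : gibbsCondExp ν R U (fun ω => f ω * g ω) x = gibbsCondExp ν R U f x * g x := by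
  have h_const (ω : ∀ i, E i) : g (R.piecewise ω x) = g x :=
    hg fun i hi => Set.piecewise_eq_of_notMem R ω x hi
  simp only [gibbsCondExp, h_const, integral_mul_const]

lemma gibbsCondExp_of_dependsOn (hf : DependsOn f R) (x : ∀ i, E i) :
    gibbsCondExp ν R U f x
      = ∫ ω, f ω ∂((Measure.infinitePi ν).tilted fun ω => U (R.piecewise ω x)) := by
  have h_eq (ω : ∀ i, E i) : f (R.piecewise ω x) = f ω :=
    hf fun i hi => Set.piecewise_eq_of_mem R ω x hi
  simp only [gibbsCondExp, h_eq]

variable [∀ i, IsProbabilityMeasure (ν i)]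

lemma measurePreserving_piecewise_infinitePi :
    MeasurePreserving (fun p : (∀ i, E i) × (∀ i, E i) => R.piecewise p.1 p.2)
      ((Measure.infinitePi ν).prod (Measure.infinitePi ν)) (Measure.infinitePi ν) := by
  classical
  refine ⟨measurable_piecewise_pi R, Measure.eq_infinitePi _ fun s t ht => ?_⟩
  have h_preimage : (fun p : (∀ i, E i) × (∀ i, E i) => R.piecewise p.1 p.2) ⁻¹' (Set.pi s t)
      = Set.pi (s.filter (· ∈ R) : Finset ι) t ×ˢ Set.pi (s.filter (· ∉ R) : Finset ι) t := by
    ext p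
    simp only [mem_preimage, Set.mem_pi, Finset.mem_coe, mem_prod, Finset.mem_filter,
      Set.piecewise]
    grind
  rw [Measure.map_apply (measurable_piecewise_pi R) (.pi s.countable_toSet fun i _ => ht i),
    h_preimage, Measure.prod_prod, Measure.infinitePi_pi _ fun i _ => ht i,
    Measure.infinitePi_pi _ fun i _ => ht i, Finset.prod_filter_mul_prod_filter_not]

lemma integral_infinitePi_eq_integral_piecewise {F : (∀ i, E i) → ℝ} (hF : BddMeasurable F) :
    ∫ ω, F ω ∂(Measure.infinitePi ν)
      = ∫ x, ∫ ω, F (R.piecewise ω x) ∂(Measure.infinitePi ν) ∂(Measure.infinitePi ν) := by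
  have hT := measurePreserving_piecewise_infinitePi ν R
  rw [← hT.map_eq, integral_map hT.aemeasurable hF.measurable.aestronglyMeasurable, hT.map_eq,
    integral_prod_symm _ ((hF.comp hT.measurable).integrable _)]

lemma bddMeasurable_gibbsCondExp (hU : BddMeasurable U) (hf : BddMeasurable f) :
    BddMeasurable (gibbsCondExp ν R U f) := by
  have h_swap : Measurable fun p : (∀ i, E i) × (∀ i, E i) => R.piecewise p.2 p.1 :=
    (measurable_piecewise_pi R).comp measurable_swap
  obtain ⟨M, hM⟩ := hf.exists_abs_le
  refine ⟨?_, M, fun x => ?_⟩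
  · unfold gibbsCondExp
    simp_rw [integral_tilted_eq_div]
    exact (((hU.exp.mul hf).comp h_swap).integral_prod_right _).measurable.div
      ((hU.exp.comp h_swap).integral_prod_right _).measurable
  · have := (hU.comp (measurable_piecewise_left R x)).isProbabilityMeasure_tilted
      (Measure.infinitePi ν)
    exact abs_integral_le_of_abs_le _ fun ω => hM _

lemma integral_gibbsCondExp (hU : BddMeasurable U) (hf : BddMeasurable f) :
    ∫ x, gibbsCondExp ν R U f x ∂((Measure.infinitePi ν).tilted U)
      = ∫ ω, f ω ∂((Measure.infinitePi ν).tilted U) := by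
  rw [integral_tilted_eq_div, integral_tilted_eq_div,
    integral_infinitePi_eq_integral_piecewise ν R (hU.exp.mul hf),
    integral_infinitePi_eq_integral_piecewise ν R
      (hU.exp.mul (bddMeasurable_gibbsCondExp ν R hU hf))]
  congr! 3 with x
  simp only [gibbsCondExp_piecewise]
  rw [integral_mul_const, gibbsCondExp, integral_tilted_eq_div, mul_div_cancel₀]
  exact (integral_exp_pos ((hU.exp.comp (measurable_piecewise_left R x)).integrable _)).ne'

lemma covariance_gibbsCondExp_left (hU : BddMeasurable U) (hf : BddMeasurable f)
    {g : (∀ i, E i) → ℝ} (hg : BddMeasurable g) (hgR : DependsOn g Rᶜ) :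
    cov[gibbsCondExp ν R U f, g; (Measure.infinitePi ν).tilted U]
      = cov[f, g; (Measure.infinitePi ν).tilted U] := by
  have := hU.isProbabilityMeasure_tilted (Measure.infinitePi ν)
  rw [covariance_eq_sub ((bddMeasurable_gibbsCondExp ν R hU hf).memLp 2 _) (hg.memLp 2 _),
    covariance_eq_sub (hf.memLp 2 _) (hg.memLp 2 _), integral_gibbsCondExp ν R hU hf]
  simp only [Pi.mul_apply, ← gibbsCondExp_mul_of_dependsOn_compl ν R hgR]
  rw [integral_gibbsCondExp ν R hU (hf.mul hg)]

lemma gibbsCondExp_eq_integral_gibbsCondExp {S : Set ι} [∀ i, Decidable (i ∈ S)] (hRS : R ⊆ S)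
    (hU : BddMeasurable U) (hf : BddMeasurable f) (x : ∀ i, E i) :
    gibbsCondExp ν S U f x = ∫ ω, gibbsCondExp ν R U f (S.piecewise ω x)
      ∂((Measure.infinitePi ν).tilted fun ω => U (S.piecewise ω x)) := by
  rw [gibbsCondExp, ← integral_gibbsCondExp ν R (hU.comp (measurable_piecewise_left S x))
    (hf.comp (measurable_piecewise_left S x))]
  simp only [gibbsCondExp, piecewise_piecewise_of_subset hRS]

end Resampling

section Interaction

/-- The interaction of the two particles that delimit the spacings `i, …, j`, where `Φ n r` is the
interaction of two particles at distance `r` with `n` spacings between them. -/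
def interactionTerm (Φ : ℕ → ℝ → ℝ) (i j : ℤ) (ω : ℤ → ℝ) : ℝ :=
  Φ (j + 1 - i).toNat (∑ l ∈ Finset.Icc i j, ω l)

/-- The interaction of the particles to the left of the spacings in `[b, b')` with those to the
right of them, in a chain whose spacings are those in `[A, B)`. -/
def crossEnergy (Φ : ℕ → ℝ → ℝ) (A b b' B : ℤ) (ω : ℤ → ℝ) : ℝ :=
  ∑ i ∈ Finset.Ico A b, ∑ j ∈ Finset.Ico b' B, interactionTerm Φ i j ω

/-- The total interaction in a chain whose spacings are those in `[A, B)`. -/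
def hamiltonian (Φ : ℕ → ℝ → ℝ) (A B : ℤ) (ω : ℤ → ℝ) : ℝ := crossEnergy Φ A B A B ω

/-- A pair interaction of particles in a chain decaying like `n ^ (-s)` in the number `n` of
spacings between them. Neighbours (`n = 1`) do not interact: their interaction is absorbed into
the reference measure of a single spacing. -/
structure IsInteraction (Φ : ℕ → ℝ → ℝ) (b s : ℝ) : Prop where
  measurable : ∀ n, Measurable (Φ n)
  eq_zero_of_le_one : ∀ n r, n ≤ 1 → Φ n r = 0
  abs_le : ∀ n r, |Φ n r| ≤ b * (n : ℝ) ^ (-s)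

variable {Φ : ℕ → ℝ → ℝ} {b₀ s : ℝ}

lemma IsInteraction.nonneg (hΦ : IsInteraction Φ b₀ s) : 0 ≤ b₀ := by
  simpa using (abs_nonneg _).trans (hΦ.abs_le 1 0)

lemma IsInteraction.interactionTerm_eq_zero (hΦ : IsInteraction Φ b₀ s) {i j : ℤ} (h : j ≤ i)
    (ω : ℤ → ℝ) : interactionTerm Φ i j ω = 0 :=
  hΦ.eq_zero_of_le_one _ _ (by omega)

lemma IsInteraction.bddMeasurable_interactionTerm (hΦ : IsInteraction Φ b₀ s) (i j : ℤ) :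
    BddMeasurable (interactionTerm Φ i j) :=
  ⟨(hΦ.measurable _).comp (Finset.measurable_sum _ fun l _ => measurable_pi_apply l), _,
    fun _ => hΦ.abs_le _ _⟩

lemma IsInteraction.bddMeasurable_hamiltonian (hΦ : IsInteraction Φ b₀ s) (A B : ℤ) :
    BddMeasurable (hamiltonian Φ A B) := by
  unfold hamiltonian crossEnergy
  exact .sum _ fun i _ => .sum _ fun j _ => hΦ.bddMeasurable_interactionTerm i j

lemma dependsOn_hamiltonian (Φ : ℕ → ℝ → ℝ) (A B : ℤ) :
    DependsOn (hamiltonian Φ A B) (Ico A B) := by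
  intro x y h
  unfold hamiltonian crossEnergy interactionTerm
  refine Finset.sum_congr rfl fun i hi => Finset.sum_congr rfl fun j hj =>
    congrArg (Φ _) <| Finset.sum_congr rfl fun l hl => h l ?_
  simp only [Finset.mem_Ico, Finset.mem_Icc, mem_Ico] at *
  omega

lemma sum_Ico_add_sum_Ico {a b c : ℤ} (hab : a ≤ b) (hbc : b ≤ c) (f : ℤ → ℝ) :
    ∑ i ∈ Finset.Ico a b, f i + ∑ i ∈ Finset.Ico b c, f i = ∑ i ∈ Finset.Ico a c, f i := by
  rw [← Finset.sum_union (Finset.Ico_disjoint_Ico_consecutive a b c),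
    Finset.Ico_union_Ico_eq_Ico hab hbc]

lemma crossEnergy_add_crossEnergy_right {A b b' c B : ℤ} (h1 : b' ≤ c) (h2 : c ≤ B)
    (ω : ℤ → ℝ) :
    crossEnergy Φ A b b' c ω + crossEnergy Φ A b c B ω = crossEnergy Φ A b b' B ω := by
  simp only [crossEnergy, ← Finset.sum_add_distrib, sum_Ico_add_sum_Ico h1 h2]

lemma IsInteraction.hamiltonian_eq_add (hΦ : IsInteraction Φ b₀ s) {A b B : ℤ} (h1 : A ≤ b)
    (h2 : b ≤ B) (ω : ℤ → ℝ) :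
    hamiltonian Φ A B ω
      = hamiltonian Φ A b ω + hamiltonian Φ b B ω + crossEnergy Φ A b b B ω := by
  have h0 : crossEnergy Φ b B A b ω = 0 :=
    Finset.sum_eq_zero fun i hi => Finset.sum_eq_zero fun j hj =>
      hΦ.interactionTerm_eq_zero (by simp only [Finset.mem_Ico] at hi hj; omega) ω
  calc hamiltonian Φ A B ω = crossEnergy Φ A b A B ω + crossEnergy Φ b B A B ω :=
        (sum_Ico_add_sum_Ico h1 h2 _).symm
    _ = _ := by
        rw [← crossEnergy_add_crossEnergy_right h1 h2, ← crossEnergy_add_crossEnergy_right h1 h2,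
          h0, hamiltonian, hamiltonian]
        ring

lemma IsInteraction.hamiltonian_eq_sub_add (hΦ : IsInteraction Φ b₀ s) {A b b' B : ℤ}
    (h1 : A ≤ b) (h2 : b ≤ b') (h3 : b' ≤ B) (ω : ℤ → ℝ) :
    hamiltonian Φ A B ω = hamiltonian Φ A b' ω - hamiltonian Φ b b' ω + hamiltonian Φ b B ω
      + crossEnergy Φ A b b' B ω := by
  rw [hΦ.hamiltonian_eq_add h1 (h2.trans h3), hΦ.hamiltonian_eq_add h1 h2,
    ← crossEnergy_add_crossEnergy_right h2 h3]
  ring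

/-- A bound on the interaction across any block of `L` consecutive spacings; for `L = 0` it bounds
the interaction of the two parts of a chain that is cut at a particle. -/
def CrossBound (Φ : ℕ → ℝ → ℝ) (L : ℕ) (κ : ℝ) : Prop :=
  ∀ (A b B : ℤ) (ω : ℤ → ℝ), |crossEnergy Φ A b (b + L) B ω| ≤ κ

lemma CrossBound.nonneg {L : ℕ} {κ : ℝ} (hκ : CrossBound Φ L κ) : 0 ≤ κ :=
  (abs_nonneg _).trans (hκ 0 0 0 0)

lemma CrossBound.abs_hamiltonian_piecewise_sub_le (hΦ : IsInteraction Φ b₀ s) {L : ℕ} {κ : ℝ}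
    (hκ : CrossBound Φ L κ) {A b B B' : ℤ} (hA : A ≤ b) (hB : b + L ≤ B) (hB' : b + L ≤ B')
    {x x' : ℤ → ℝ} (hx : ∀ i ∈ Ico b (b + L), x i = x' i) (ω : ℤ → ℝ) :
    |hamiltonian Φ A B ((Iio b).piecewise ω x) - hamiltonian Φ A B' ((Iio b).piecewise ω x')
      - (hamiltonian Φ b B x - hamiltonian Φ b B' x')| ≤ 2 * κ := by
  have hL : b ≤ b + L := by omega
  have left : hamiltonian Φ A (b + L) ((Iio b).piecewise ω x)
      = hamiltonian Φ A (b + L) ((Iio b).piecewise ω x') :=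
    dependsOn_hamiltonian Φ A (b + L) fun i hi => by
      by_cases hib : i < b
      · simp only [piecewise_eq_of_mem _ _ _ (mem_Iio.2 hib)]
      · simpa only [piecewise_eq_of_notMem _ _ _ (mt mem_Iio.1 hib)]
          using hx i ⟨not_lt.1 hib, hi.2⟩
  have right (C : ℤ) (y : ℤ → ℝ) :
      hamiltonian Φ b C ((Iio b).piecewise ω y) = hamiltonian Φ b C y :=
    dependsOn_hamiltonian Φ b C fun i hi =>
      piecewise_eq_of_notMem _ _ _ (notMem_Iio.2 hi.1)
  have block : hamiltonian Φ b (b + L) x = hamiltonian Φ b (b + L) x' :=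
    dependsOn_hamiltonian Φ b (b + L) hx
  rw [hΦ.hamiltonian_eq_sub_add hA hL hB, hΦ.hamiltonian_eq_sub_add hA hL hB', left]
  simp only [right, block]
  have hxκ := abs_le.1 (hκ A b B ((Iio b).piecewise ω x))
  have hxκ' := abs_le.1 (hκ A b B' ((Iio b).piecewise ω x'))
  rw [abs_le]
  constructor <;> linarith [hxκ.1, hxκ.2, hxκ'.1, hxκ'.2]

lemma sum_range_rpow_neg_le {x σ : ℝ} (hx : 0 < x) (hσ : 1 < σ) (N : ℕ) :
    ∑ n ∈ Finset.range N, (x + n + 1) ^ (-σ) ≤ x ^ (1 - σ) / (σ - 1) := by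
  have hanti : AntitoneOn (fun y : ℝ => y ^ (-σ)) (Icc x (x + N)) :=
    (Real.antitoneOn_rpow_Ioi_of_exponent_nonpos (by linarith)).mono
      fun y hy => hx.trans_le hy.1
  have hnotMem : (0 : ℝ) ∉ uIcc x (x + N) := by
    rw [uIcc_of_le (by simp)]
    exact fun h => hx.not_ge h.1
  calc ∑ n ∈ Finset.range N, (x + n + 1) ^ (-σ) ≤ ∫ y in x..x + N, y ^ (-σ) := by
        simpa only [Nat.cast_add, Nat.cast_one, ← add_assoc] using hanti.sum_le_integral
    _ = (x ^ (1 - σ) - (x + N) ^ (1 - σ)) / (σ - 1) := by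
        rw [integral_rpow (.inr ⟨by linarith, hnotMem⟩), ← neg_div_neg_eq]
        ring_nf
    _ ≤ x ^ (1 - σ) / (σ - 1) := by
        have : 0 ≤ (x + N) ^ (1 - σ) := by positivity
        gcongr
        linarith

lemma sum_range_sum_range_rpow_neg_le {x : ℝ} (hx : 0 < x) (hs : 2 < s) (N N' : ℕ) :
    ∑ d ∈ Finset.range N, ∑ e ∈ Finset.range N', (x + d + e + 2) ^ (-s)
      ≤ x ^ (2 - s) / ((s - 1) * (s - 2)) := by
  have hs1 : 0 < s - 1 := by linarith
  have inner (d : ℕ) : ∑ e ∈ Finset.range N', (x + d + e + 2) ^ (-s)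
      ≤ (x + d + 1) ^ (-(s - 1)) / (s - 1) := by
    have h := sum_range_rpow_neg_le (x := x + d + 1) (by positivity)
      (show 1 < s by linarith) N'
    convert h using 3 <;> ring
  have outer := sum_range_rpow_neg_le hx (show 1 < s - 1 by linarith) N
  calc ∑ d ∈ Finset.range N, ∑ e ∈ Finset.range N', (x + d + e + 2) ^ (-s)
      ≤ (∑ d ∈ Finset.range N, (x + d + 1) ^ (-(s - 1))) / (s - 1) := by
        rw [Finset.sum_div]
        exact Finset.sum_le_sum fun d _ => inner d
    _ ≤ x ^ (1 - (s - 1)) / (s - 1 - 1) / (s - 1) := by gcongr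
    _ = x ^ (2 - s) / ((s - 1) * (s - 2)) := by
        rw [div_div, mul_comm]
        ring_nf

lemma sum_Ico_int_eq_sum_range (a b : ℤ) (f : ℤ → ℝ) :
    ∑ j ∈ Finset.Ico a b, f j = ∑ n ∈ Finset.range (b - a).toNat, f (a + n) :=
  Finset.sum_map _ _ _

lemma sum_Ico_int_eq_sum_range_sub (a b : ℤ) (f : ℤ → ℝ) :
    ∑ i ∈ Finset.Ico a b, f i = ∑ n ∈ Finset.range (b - a).toNat, f (b - 1 - n) := by
  rw [sum_Ico_int_eq_sum_range, ← Finset.sum_range_reflect]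
  refine Finset.sum_congr rfl fun n hn => congrArg f ?_
  rw [Finset.mem_range] at hn
  omega

lemma IsInteraction.abs_crossEnergy_le (hΦ : IsInteraction Φ b₀ s) (A b B : ℤ) (L : ℕ)
    (ω : ℤ → ℝ) :
    |crossEnergy Φ A b (b + L) B ω| ≤ b₀ * ∑ d ∈ Finset.range (b - A).toNat,
      ∑ e ∈ Finset.range (B - (b + L)).toNat, ((L : ℝ) + d + e + 2) ^ (-s) := by
  simp only [crossEnergy, sum_Ico_int_eq_sum_range_sub A b, sum_Ico_int_eq_sum_range (b + L),
    Finset.mul_sum]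
  refine (Finset.abs_sum_le_sum_abs _ _).trans (Finset.sum_le_sum fun d _ =>
    (Finset.abs_sum_le_sum_abs _ _).trans (Finset.sum_le_sum fun e _ => ?_))
  refine (hΦ.abs_le _ _).trans_eq ?_
  rw [show (b + L + e + 1 - (b - 1 - d) : ℤ).toNat = L + d + e + 2 by omega]
  push_cast
  rfl

/-- The constant such that, for an interaction bounded by `n ^ (-s)`, the interaction across `L`
spacings is at most `decayConst s * (L + 1) ^ (2 - s)`. -/
def decayConst (s : ℝ) : ℝ := 2 ^ s / ((s - 1) * (s - 2))

lemma decayConst_pos (hs : 2 < s) : 0 < decayConst s :=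
  div_pos (by positivity) (mul_pos (by linarith) (by linarith))

lemma rpow_neg_le_two_rpow_mul {x y : ℝ} (hx : 0 < x) (hxy : x ≤ 2 * y) (hs : 0 ≤ s) :
    y ^ (-s) ≤ 2 ^ s * x ^ (-s) := by
  calc y ^ (-s) ≤ (x / 2) ^ (-s) :=
        Real.rpow_le_rpow_of_nonpos (by positivity) (by linarith) (by linarith)
    _ = 2 ^ s * x ^ (-s) := by
        rw [Real.div_rpow hx.le two_pos.le, Real.rpow_neg two_pos.le, div_inv_eq_mul, mul_comm]

lemma IsInteraction.crossBound (hΦ : IsInteraction Φ b₀ s) (hs : 2 < s) (L : ℕ) :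
    CrossBound Φ L (b₀ * decayConst s * ((L : ℝ) + 1) ^ (2 - s)) := by
  intro A b B ω
  rw [mul_assoc]
  refine (hΦ.abs_crossEnergy_le A b B L ω).trans (mul_le_mul_of_nonneg_left ?_ hΦ.nonneg)
  calc _ ≤ ∑ d ∈ Finset.range (b - A).toNat, ∑ e ∈ Finset.range (B - (b + L)).toNat,
        2 ^ s * ((L : ℝ) + 1 + d + e + 2) ^ (-s) := by
        gcongr with d _ e _
        refine rpow_neg_le_two_rpow_mul (by positivity) ?_ (by linarith)
        linarith [L.cast_nonneg (α := ℝ), d.cast_nonneg (α := ℝ), e.cast_nonneg (α := ℝ)]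
    _ ≤ 2 ^ s * (((L : ℝ) + 1) ^ (2 - s) / ((s - 1) * (s - 2))) := by
        simp_rw [← Finset.mul_sum]
        gcongr
        exact sum_range_sum_range_rpow_neg_le (by positivity) hs _ _
    _ = decayConst s * ((L : ℝ) + 1) ^ (2 - s) := by
        rw [decayConst]
        ring

lemma crossBound_zero_of_forall_eq_zero {L : ℕ} (h : ∀ n r, L + 2 ≤ n → Φ n r = 0) :
    CrossBound Φ L 0 := by
  intro A b B ω
  rw [crossEnergy, Finset.sum_eq_zero, abs_zero]
  refine fun i hi => Finset.sum_eq_zero fun j hj => h _ _ ?_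
  simp only [Finset.mem_Ico] at hi hj
  omega

end Interaction

section LossOfMemory

/-- The bound for the influence on one another of two parts of a chain that are separated by
`q - 1` blocks, where `K` bounds the interaction across a cut and `κ` the interaction across a
block. -/
def memoryRate (K κ : ℝ) (q : ℕ) : ℝ :=
  (1 - Real.exp (-(4 * K))) ^ q + Real.exp (4 * K) * (1 - Real.exp (-(4 * κ)))

lemma one_sub_exp_neg_nonneg {t : ℝ} (ht : 0 ≤ t) : 0 ≤ 1 - Real.exp (-t) :=
  sub_nonneg.2 (Real.exp_le_one_iff.2 (neg_nonpos.2 ht))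

lemma memoryRate_succ (K κ : ℝ) (q : ℕ) :
    memoryRate K κ (q + 1)
      = (1 - Real.exp (-(4 * K))) * memoryRate K κ q + (1 - Real.exp (-(4 * κ))) := by
  have hinv : Real.exp (-(4 * K)) * Real.exp (4 * K) = 1 := by
    rw [← Real.exp_add, neg_add_cancel, Real.exp_zero]
  rw [memoryRate, memoryRate, pow_succ]
  linear_combination (1 - Real.exp (-(4 * κ))) * hinv

lemma le_memoryRate_one (K : ℝ) {κ : ℝ} (hκ : 0 ≤ κ) :
    1 - Real.exp (-(4 * K)) ≤ memoryRate K κ 1 := by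
  rw [memoryRate, pow_one, le_add_iff_nonneg_right]
  exact mul_nonneg (Real.exp_pos _).le (one_sub_exp_neg_nonneg (by positivity))

variable (ν : Measure ℝ) [IsProbabilityMeasure ν] {Φ : ℕ → ℝ → ℝ} {b₀ s : ℝ}

lemma IsInteraction.bddMeasurable_hamiltonian_piecewise (hΦ : IsInteraction Φ b₀ s) (A B c : ℤ)
    (x : ℤ → ℝ) : BddMeasurable fun ω => hamiltonian Φ A B ((Iio c).piecewise ω x) :=
  (hΦ.bddMeasurable_hamiltonian A B).comp (measurable_piecewise_left _ x)

lemma CrossBound.abs_integral_tilted_hamiltonian_sub_le (hΦ : IsInteraction Φ b₀ s) {L : ℕ}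
    {κ : ℝ} (hκ : CrossBound Φ L κ) {A c B B' : ℤ} (hA : A ≤ c) (hB : c + L ≤ B)
    (hB' : c + L ≤ B') {x x' : ℤ → ℝ} (hx : ∀ i ∈ Ico c (c + L), x i = x' i) {h : (ℤ → ℝ) → ℝ}
    (hh : BddMeasurable h) {D : ℝ} (hD : ∀ y y', |h y - h y'| ≤ D) :
    |∫ ω, h ω ∂((Measure.infinitePi fun _ : ℤ => ν).tilted
          fun ω => hamiltonian Φ A B ((Iio c).piecewise ω x))
      - ∫ ω, h ω ∂((Measure.infinitePi fun _ : ℤ => ν).tilted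
          fun ω => hamiltonian Φ A B' ((Iio c).piecewise ω x'))|
      ≤ (1 - Real.exp (-(4 * κ))) * D := by
  rw [show 4 * κ = 2 * (2 * κ) by ring]
  exact abs_integral_tilted_sub_le _ (hΦ.bddMeasurable_hamiltonian_piecewise A B c x)
    (hΦ.bddMeasurable_hamiltonian_piecewise A B' c x')
    (hκ.abs_hamiltonian_piecewise_sub_le hΦ hA hB hB' hx) hh hD

lemma CrossBound.abs_gibbsCondExp_sub_le (hΦ : IsInteraction Φ b₀ s) {L : ℕ}
    {κ : ℝ} (hκ : CrossBound Φ L κ) {A c B B' : ℤ} (hA : A ≤ c) (hB : c + L ≤ B)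
    (hB' : c + L ≤ B') {x x' : ℤ → ℝ} (hx : ∀ i ∈ Ico c (c + L), x i = x' i) {f : (ℤ → ℝ) → ℝ}
    (hf : BddMeasurable f) (hfc : DependsOn f (Iio c)) {D : ℝ} (hD : ∀ y y', |f y - f y'| ≤ D) :
    |gibbsCondExp (fun _ => ν) (Iio c) (hamiltonian Φ A B) f x
      - gibbsCondExp (fun _ => ν) (Iio c) (hamiltonian Φ A B') f x'|
      ≤ (1 - Real.exp (-(4 * κ))) * D := by
  rw [gibbsCondExp_of_dependsOn _ _ hfc, gibbsCondExp_of_dependsOn _ _ hfc]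
  exact hκ.abs_integral_tilted_hamiltonian_sub_le ν hΦ hA hB hB' hx hf hD

/-- One more block: the law of the configuration left of the block changes by a factor
`1 - e^(-4K)` at most, and the conditional expectation given that configuration by the influence
`1 - e^(-4κ)` across the block. -/
lemma abs_gibbsCondExp_add_sub_le (hΦ : IsInteraction Φ b₀ s) {K κ : ℝ} {L : ℕ}
    (hK : CrossBound Φ 0 K) (hκ : CrossBound Φ L κ) {A c B B' : ℤ} (hA : A ≤ c)
    (hB : c + L ≤ B) (hB' : c + L ≤ B') {f : (ℤ → ℝ) → ℝ} (hf : BddMeasurable f)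
    (hfc : DependsOn f (Iio c)) {D r : ℝ} (hD : ∀ y y', |f y - f y'| ≤ D)
    (hr : ∀ y y', |gibbsCondExp (fun _ => ν) (Iio c) (hamiltonian Φ A B) f y
      - gibbsCondExp (fun _ => ν) (Iio c) (hamiltonian Φ A B) f y'| ≤ r) (x x' : ℤ → ℝ) :
    |gibbsCondExp (fun _ => ν) (Iio (c + L)) (hamiltonian Φ A B) f x
      - gibbsCondExp (fun _ => ν) (Iio (c + L)) (hamiltonian Φ A B') f x'|
      ≤ (1 - Real.exp (-(4 * K))) * r + (1 - Real.exp (-(4 * κ))) * D := by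
  have hsub : Iio c ⊆ Iio (c + L : ℤ) := Iio_subset_Iio (by omega)
  have hH (C : ℤ) := hΦ.bddMeasurable_hamiltonian A C
  rw [gibbsCondExp_eq_integral_gibbsCondExp _ _ hsub (hH B) hf,
    gibbsCondExp_eq_integral_gibbsCondExp _ _ hsub (hH B') hf]
  set T' := (Measure.infinitePi fun _ : ℤ => ν).tilted
    fun ω => hamiltonian Φ A B' ((Iio (c + L : ℤ)).piecewise ω x')
  have : IsProbabilityMeasure T' :=
    (hΦ.bddMeasurable_hamiltonian_piecewise A B' _ x').isProbabilityMeasure_tilted _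
  have hg (C : ℤ) (y : ℤ → ℝ) :=
    (bddMeasurable_gibbsCondExp (fun _ => ν) (Iio c) (hH C) hf).comp
      (measurable_piecewise_left (Iio (c + L : ℤ)) y)
  refine (abs_sub_le _ (∫ ω, gibbsCondExp (fun _ => ν) (Iio c) (hamiltonian Φ A B) f
    ((Iio (c + L : ℤ)).piecewise ω x) ∂T') _).trans (add_le_add ?_ ?_)
  · exact hK.abs_integral_tilted_hamiltonian_sub_le ν hΦ (by omega) (by simpa using hB)
      (by simpa using hB') (by simp) (hg B x) fun y y' => hr _ _
  · rw [← integral_sub ((hg B x).integrable _) ((hg B' x').integrable _)]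
    refine abs_integral_le_of_abs_le T' fun ω => ?_
    refine hκ.abs_gibbsCondExp_sub_le ν hΦ hA hB hB' (fun i hi => ?_) hf hfc hD
    simp only [piecewise_eq_of_mem _ _ _ (mem_Iio.2 hi.2)]

lemma abs_gibbsCondExp_sub_le_memoryRate (hΦ : IsInteraction Φ b₀ s) {K κ : ℝ} {L : ℕ}
    (hK : CrossBound Φ 0 K) (hκ : CrossBound Φ L κ) {A b : ℤ} (hA : A ≤ b) {f : (ℤ → ℝ) → ℝ}
    (hf : BddMeasurable f) (hfb : DependsOn f (Iio b)) {D : ℝ} (hD : ∀ y y', |f y - f y'| ≤ D)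
    (q : ℕ) {B B' : ℤ} (hB : b + q * L ≤ B) (hB' : b + q * L ≤ B') (x x' : ℤ → ℝ) :
    |gibbsCondExp (fun _ => ν) (Iio (b + q * L)) (hamiltonian Φ A B) f x
      - gibbsCondExp (fun _ => ν) (Iio (b + q * L)) (hamiltonian Φ A B') f x'|
      ≤ memoryRate K κ (q + 1) * D := by
  have hD0 : 0 ≤ D := (abs_nonneg _).trans (hD 0 0)
  induction q generalizing B B' x x' with
  | zero =>
    simp only [Nat.cast_zero, zero_mul, add_zero] at *
    refine (hK.abs_gibbsCondExp_sub_le ν hΦ hA (by simpa using hB) (by simpa using hB')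
      (by simp) hf hfb hD).trans ?_
    gcongr
    exact le_memoryRate_one K hκ.nonneg
  | succ q ih =>
    have hc : b + ((q + 1 : ℕ) : ℤ) * L = b + q * L + L := by push_cast; ring
    have hqL : (0 : ℤ) ≤ q * L := by positivity
    rw [hc] at hB hB' ⊢
    rw [memoryRate_succ, add_mul, mul_assoc]
    exact abs_gibbsCondExp_add_sub_le ν hΦ hK hκ (by omega) hB hB' hf
      (hfb.mono (Iio_subset_Iio (by omega))) hD (ih (by omega) (by omega)) x x'

end LossOfMemory

section VolumeGibbs

variable (ν : Measure ℝ)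

/-- The Gibbs measure of a chain whose spacings are those in `[A, B)`, relative to the reference
law `ν` of a spacing. The spacings off `[A, B)` are independent with law `ν`, so that the Gibbs
measures of all chains live on one space. -/
def volGibbs (Φ : ℕ → ℝ → ℝ) (A B : ℤ) : Measure (ℤ → ℝ) :=
  (Measure.infinitePi fun _ => ν).tilted (hamiltonian Φ A B)

variable [IsProbabilityMeasure ν] {Φ : ℕ → ℝ → ℝ} {b₀ s : ℝ}

lemma IsInteraction.isProbabilityMeasure_volGibbs (hΦ : IsInteraction Φ b₀ s) (A B : ℤ) :
    IsProbabilityMeasure (volGibbs ν Φ A B) :=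
  (hΦ.bddMeasurable_hamiltonian A B).isProbabilityMeasure_tilted _

lemma abs_covariance_volGibbs_le (hΦ : IsInteraction Φ b₀ s) {K κ : ℝ} {L : ℕ}
    (hK : CrossBound Φ 0 K) (hκ : CrossBound Φ L κ) {A b B : ℤ} (q : ℕ) (hA : A ≤ b)
    (hB : b + q * L ≤ B) {f g : (ℤ → ℝ) → ℝ} (hf : BddMeasurable f) (hg : BddMeasurable g)
    (hfb : DependsOn f (Iio b)) (hgb : DependsOn g (Ici (b + q * L)))
    {F G : ℝ} (hF : ∀ x, |f x| ≤ F) (hG : ∀ x, |g x| ≤ G) :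
    |cov[f, g; volGibbs ν Φ A B]| ≤ memoryRate K κ (q + 1) * F * G := by
  have := hΦ.isProbabilityMeasure_volGibbs ν A B
  have hH := hΦ.bddMeasurable_hamiltonian A B
  have hF2 (y y' : ℤ → ℝ) : |f y - f y'| ≤ 2 * F :=
    (abs_sub _ _).trans (by linarith [hF y, hF y'])
  rw [volGibbs, ← covariance_gibbsCondExp_left _ (Iio (b + q * L)) hH hf hg (by rwa [compl_Iio])]
  refine abs_covariance_le (volGibbs ν Φ A B) (bddMeasurable_gibbsCondExp _ _ hH hf) hg
    (fun x x' => ?_) hG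
  rw [mul_left_comm]
  exact abs_gibbsCondExp_sub_le_memoryRate ν hΦ hK hκ hA hf hfb hF2 q hB hB x x'

lemma measurePreserving_comp_volGibbs (hΦ : IsInteraction Φ b₀ s) {e : ℤ → ℤ}
    (he : Function.Injective e) {A B A' B' : ℤ}
    (h : ∀ ω : ℤ → ℝ, hamiltonian Φ A B (fun i => ω (e i)) = hamiltonian Φ A' B' ω) :
    MeasurePreserving (fun (ω : ℤ → ℝ) i => ω (e i)) (volGibbs ν Φ A' B') (volGibbs ν Φ A B) := by
  have hprod : MeasurePreserving (fun (ω : ℤ → ℝ) i => ω (e i))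
      (Measure.infinitePi fun _ => ν) (Measure.infinitePi fun _ => ν) :=
    ⟨by fun_prop, Measure.map_infinitePi_infinitePi_of_inj he⟩
  simpa only [volGibbs, h]
    using measurePreserving_tilted hprod (hΦ.bddMeasurable_hamiltonian A B).measurable

lemma hamiltonian_comp_add (A B a : ℤ) (ω : ℤ → ℝ) :
    hamiltonian Φ A B (fun i => ω (i + a)) = hamiltonian Φ (A + a) (B + a) ω := by
  simp only [hamiltonian, crossEnergy, interactionTerm, ← Finset.map_add_right_Ico A B a,
    ← Finset.map_add_right_Icc _ _ a, Finset.sum_map, addRightEmbedding_apply]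
  congr! 4
  ring

lemma sum_Ico_neg_one_sub (A B : ℤ) (f : ℤ → ℝ) :
    ∑ i ∈ Finset.Ico A B, f (-1 - i) = ∑ i ∈ Finset.Ico (-B) (-A), f i :=
  Finset.sum_nbij' (fun i => -1 - i) (fun i => -1 - i) (by grind) (by grind) (by grind)
    (by grind) fun _ _ => rfl

lemma hamiltonian_comp_neg_one_sub (A B : ℤ) (ω : ℤ → ℝ) :
    hamiltonian Φ A B (fun i => ω (-1 - i)) = hamiltonian Φ (-B) (-A) ω := by
  have hterm (i j : ℤ) : interactionTerm Φ (-1 - j) (-1 - i) (fun i => ω (-1 - i))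
      = interactionTerm Φ i j ω := by
    unfold interactionTerm
    congr 1
    · congr 1
      ring
    · exact Finset.sum_nbij' (fun i => -1 - i) (fun i => -1 - i) (by grind) (by grind) (by grind)
        (by grind) fun _ _ => rfl
  unfold hamiltonian crossEnergy
  rw [Finset.sum_comm]
  simp only [← sum_Ico_neg_one_sub A B, ← hterm, sub_sub_cancel]

lemma measurePreserving_shift_volGibbs (hΦ : IsInteraction Φ b₀ s) (A B a : ℤ) :
    MeasurePreserving (fun (ω : ℤ → ℝ) i => ω (i + a)) (volGibbs ν Φ (A + a) (B + a))
      (volGibbs ν Φ A B) :=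
  measurePreserving_comp_volGibbs ν hΦ (add_left_injective a) (hamiltonian_comp_add A B a)

lemma measurePreserving_reflect_volGibbs (hΦ : IsInteraction Φ b₀ s) (A B : ℤ) :
    MeasurePreserving (fun (ω : ℤ → ℝ) i => ω (-1 - i)) (volGibbs ν Φ (-B) (-A))
      (volGibbs ν Φ A B) :=
  measurePreserving_comp_volGibbs ν hΦ sub_right_injective (hamiltonian_comp_neg_one_sub A B)

lemma abs_integral_volGibbs_sub_right_le (hΦ : IsInteraction Φ b₀ s) {K κ : ℝ} {L : ℕ}
    (hK : CrossBound Φ 0 K) (hκ : CrossBound Φ L κ) (q : ℕ) {A b B B' : ℤ} (hA : A ≤ b)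
    (hB : b + q * L ≤ B) (hB' : b + q * L ≤ B') {f : (ℤ → ℝ) → ℝ} (hf : BddMeasurable f)
    (hfb : DependsOn f (Iio b)) {D : ℝ} (hD : ∀ y y', |f y - f y'| ≤ D) :
    |∫ ω, f ω ∂(volGibbs ν Φ A B) - ∫ ω, f ω ∂(volGibbs ν Φ A B')|
      ≤ memoryRate K κ (q + 1) * D := by
  have := hΦ.isProbabilityMeasure_volGibbs ν A B
  have := hΦ.isProbabilityMeasure_volGibbs ν A B'
  have hH (C : ℤ) := hΦ.bddMeasurable_hamiltonian A C
  have h_resample (C : ℤ) := integral_gibbsCondExp (fun _ => ν) (Iio (b + q * L)) (hH C) hf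
  rw [volGibbs, ← h_resample, volGibbs, ← h_resample]
  exact abs_integral_sub_integral_le (volGibbs ν Φ A B) (volGibbs ν Φ A B')
    (bddMeasurable_gibbsCondExp _ _ (hH B) hf) (bddMeasurable_gibbsCondExp _ _ (hH B') hf)
    fun x x' => abs_gibbsCondExp_sub_le_memoryRate ν hΦ hK hκ hA hf hfb hD q hB hB' x x'

lemma abs_integral_volGibbs_sub_left_le (hΦ : IsInteraction Φ b₀ s) {K κ : ℝ} {L : ℕ}
    (hK : CrossBound Φ 0 K) (hκ : CrossBound Φ L κ) (q : ℕ) {A A' a B : ℤ} (haB : a ≤ B)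
    (hA : A ≤ a - q * L) (hA' : A' ≤ a - q * L) {f : (ℤ → ℝ) → ℝ} (hf : BddMeasurable f)
    (hfa : DependsOn f (Ici a)) {D : ℝ} (hD : ∀ y y', |f y - f y'| ≤ D) :
    |∫ ω, f ω ∂(volGibbs ν Φ A B) - ∫ ω, f ω ∂(volGibbs ν Φ A' B)|
      ≤ memoryRate K κ (q + 1) * D := by
  have h_reflect (C : ℤ) := measurePreserving_reflect_volGibbs ν hΦ C B
  rw [← hf.integral_comp (h_reflect A), ← hf.integral_comp (h_reflect A')]
  refine abs_integral_volGibbs_sub_right_le ν hΦ hK hκ q (b := -a) (by omega) (by omega)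
    (by omega) (hf.comp (h_reflect A).measurable) (fun x y h => hfa fun i hi => h _ ?_)
    fun y y' => hD _ _
  simp only [mem_Ici, mem_Iio] at *
  omega

lemma abs_integral_volGibbs_sub_le (hΦ : IsInteraction Φ b₀ s) {K κ : ℝ} {L : ℕ}
    (hK : CrossBound Φ 0 K) (hκ : CrossBound Φ L κ) (q : ℕ) {A A' B B' a b : ℤ} (hab : a ≤ b)
    (hA : A ≤ a - q * L) (hA' : A' ≤ a - q * L) (hB : b + q * L ≤ B) (hB' : b + q * L ≤ B')
    {f : (ℤ → ℝ) → ℝ} (hf : BddMeasurable f) (hfab : DependsOn f (Ico a b)) {D : ℝ}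
    (hD : ∀ y y', |f y - f y'| ≤ D) :
    |∫ ω, f ω ∂(volGibbs ν Φ A B) - ∫ ω, f ω ∂(volGibbs ν Φ A' B')|
      ≤ 2 * (memoryRate K κ (q + 1) * D) := by
  have hqL : (0 : ℤ) ≤ q * L := by positivity
  have h_right := abs_integral_volGibbs_sub_right_le ν hΦ hK hκ q (A := A) (by omega) hB hB' hf
    (hfab.mono Ico_subset_Iio_self) hD
  have h_left := abs_integral_volGibbs_sub_left_le ν hΦ hK hκ q (B := B') (by omega) hA hA' hf
    (hfab.mono Ico_subset_Ici_self) hD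
  linarith [abs_sub_le (∫ ω, f ω ∂(volGibbs ν Φ A B)) (∫ ω, f ω ∂(volGibbs ν Φ A B'))
    (∫ ω, f ω ∂(volGibbs ν Φ A' B'))]

end VolumeGibbs

section WeakLimits

lemma isTightMeasureSet_pi {ι : Type*} [Countable ι] {X : ι → Type*}
    [∀ i, TopologicalSpace (X i)] [∀ i, MeasurableSpace (X i)] {𝒮 : Set (Measure (∀ i, X i))}
    (h : ∀ i, IsTightMeasureSet ((fun P => P.map (Function.eval i)) '' 𝒮)) :
    IsTightMeasureSet 𝒮 := by
  simp only [isTightMeasureSet_iff_exists_isCompact_measure_compl_le, forall_mem_image] at h ⊢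
  intro ε hε
  obtain ⟨δ, hδ, hsum⟩ := ENNReal.exists_pos_sum_of_countable' hε.ne' ι
  choose K hK hKδ using fun i => h i (δ i) (hδ i)
  refine ⟨Set.pi univ K, isCompact_univ_pi hK, fun P hP => ?_⟩
  have h_compl : (Set.pi univ K)ᶜ = ⋃ i, Function.eval i ⁻¹' (K i)ᶜ := by
    ext x
    simp
  calc P (Set.pi univ K)ᶜ ≤ ∑' i, P (Function.eval i ⁻¹' (K i)ᶜ) :=
        h_compl ▸ measure_iUnion_le _
    _ ≤ ∑' i, δ i := ENNReal.tsum_le_tsum fun i =>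
        (Measure.le_map_apply (measurable_pi_apply i).aemeasurable _).trans (hKδ i hP)
    _ ≤ ε := hsum.le

lemma isTightMeasureSet_setOf_le {X : Type*} [TopologicalSpace X] [MeasurableSpace X]
    {ρ : Measure X} (hρ : IsTightMeasureSet {ρ}) : IsTightMeasureSet {P | P ≤ ρ} := by
  simp only [isTightMeasureSet_iff_exists_isCompact_measure_compl_le, mem_singleton_iff,
    forall_eq] at hρ ⊢
  exact fun ε hε => (hρ ε hε).imp fun K hK => ⟨hK.1, fun P hP => (hP _).trans hK.2⟩

variable {E : Type*} [TopologicalSpace E] [TopologicalSpace.PseudoMetrizableSpace E]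
  [MeasurableSpace E] [BorelSpace E]

lemma exists_boundedContinuous_abs_le_integral_sub_le (P : Measure E)
    [IsFiniteMeasure P] {h : E → ℝ} (hh : BddMeasurable h) {M : ℝ}
    (hM : ∀ x, |h x| ≤ M) (hM0 : 0 ≤ M) {δ : ℝ} (hδ : 0 < δ) :
    ∃ g : BoundedContinuousFunction E ℝ, (∀ x, |g x| ≤ M) ∧ ∫ x, |h x - g x| ∂P ≤ δ := by
  obtain ⟨g, hg, hg_int⟩ := (hh.integrable P).exists_boundedContinuous_integral_sub_le hδ
  have h_mem (x : E) : h x ∈ Icc (-M) M := abs_le.1 (hM x)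
  have hMM : -M ≤ M := by linarith
  let g' : BoundedContinuousFunction E ℝ :=
    .ofNormedAddCommGroup (fun x => (projIcc (-M) M hMM (g x) : ℝ)) (by fun_prop) M
      fun x => abs_le.2 (projIcc (-M) M hMM (g x)).2
  refine ⟨g', fun x => abs_le.2 (projIcc (-M) M hMM (g x)).2, le_trans ?_ hg⟩
  refine integral_mono ((hh.integrable P).sub (g'.integrable P)).abs
    ((hh.integrable P).sub hg_int).norm fun x => ?_
  calc |h x - g' x| = |(projIcc (-M) M hMM (h x) : ℝ) - projIcc (-M) M hMM (g x)| := by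
        rw [projIcc_of_mem hMM (h_mem x)]; rfl
    _ ≤ |h x - g x| := abs_projIcc_sub_projIcc hMM

lemma abs_integral_sub_integral_le_of_forall_boundedContinuous (P P' : Measure E)
    [IsFiniteMeasure P] [IsFiniteMeasure P'] {M ε : ℝ} (hM0 : 0 ≤ M)
    (hε : ∀ g : BoundedContinuousFunction E ℝ, (∀ x, |g x| ≤ M) →
      |∫ x, g x ∂P - ∫ x, g x ∂P'| ≤ ε) {h : E → ℝ} (hh : BddMeasurable h)
    (hM : ∀ x, |h x| ≤ M) : |∫ x, h x ∂P - ∫ x, h x ∂P'| ≤ ε := by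
  refine le_of_forall_pos_le_add fun δ hδ => ?_
  obtain ⟨g, hgM, hg⟩ := exists_boundedContinuous_abs_le_integral_sub_le (P + P') hh hM hM0 hδ
  have h_int (Q : Measure E) [IsFiniteMeasure Q] : Integrable (fun x => h x - g x) Q :=
    (hh.integrable Q).sub (g.integrable Q)
  have h_diff (Q : Measure E) [IsFiniteMeasure Q] :
      |∫ x, h x ∂Q - ∫ x, g x ∂Q| ≤ ∫ x, |h x - g x| ∂Q := by
    rw [← integral_sub (hh.integrable Q) (g.integrable Q)]
    exact abs_integral_le_integral_abs
  rw [integral_add_measure (h_int P).abs (h_int P').abs] at hg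
  have hP := abs_le.1 (h_diff P)
  have hP' := abs_le.1 (h_diff P')
  have hgε := abs_le.1 (hε g hgM)
  rw [abs_le]
  constructor <;> linarith [hP.1, hP.2, hP'.1, hP'.2, hgε.1, hgε.2]

/-- If `Q` is Cauchy in total variation along `l`, it converges in total variation to any of its
weak cluster points. -/
lemma tendsto_integral_of_tendsto_of_eventually_abs_sub_le {β : Type*} {l u : Filter β}
    [NeBot u] (hul : u ≤ l) {Q : β → ProbabilityMeasure E} {P : ProbabilityMeasure E}
    (hQP : Tendsto Q u (𝓝 P))
    (hQ : ∀ M > (0 : ℝ), ∀ ε > 0, ∀ᶠ p : β × β in l ×ˢ l, ∀ h : E → ℝ, BddMeasurable h →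
      (∀ x, |h x| ≤ M) → |∫ x, h x ∂(Q p.1 : Measure E) - ∫ x, h x ∂(Q p.2 : Measure E)| ≤ ε)
    {h : E → ℝ} (hh : BddMeasurable h) :
    Tendsto (fun V => ∫ x, h x ∂(Q V : Measure E)) l (𝓝 (∫ x, h x ∂(P : Measure E))) := by
  obtain ⟨M, hM⟩ := hh.exists_abs_le
  rw [Metric.tendsto_nhds]
  intro ε hε
  obtain ⟨t, ht, htε⟩ := eventually_prod_self_iff (r := fun V V' => ∀ h : E → ℝ,
    BddMeasurable h → (∀ x, |h x| ≤ max M 1) →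
      |∫ x, h x ∂(Q V : Measure E) - ∫ x, h x ∂(Q V' : Measure E)| ≤ ε / 2) |>.1
    (hQ (max M 1) (by positivity) (ε / 2) (by positivity))
  filter_upwards [ht] with V hV
  refine lt_of_le_of_lt (abs_integral_sub_integral_le_of_forall_boundedContinuous
    (M := max M 1) _ _ (by positivity) (fun g hg => ?_) hh fun x => (hM x).trans (le_max_left _ _))
    (half_lt_self hε)
  have hlim := (ProbabilityMeasure.tendsto_iff_forall_integral_tendsto.1 hQP) g
  refine le_of_tendsto (tendsto_const_nhds.sub hlim).abs ?_
  filter_upwards [hul ht] with V' hV'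
  exact htε V hV V' hV' g ⟨g.continuous.measurable, _, hg⟩ hg

end WeakLimits

section ThermodynamicLimit

lemma tilted_infinitePi_map_eval_le {ι : Type*} [DecidableEq ι] {E : ι → Type*}
    [∀ i, MeasurableSpace (E i)] (ν : ∀ i, Measure (E i)) [∀ i, IsProbabilityMeasure (ν i)]
    {U c : (∀ i, E i) → ℝ} (hU : BddMeasurable U) (j : ι) {a : ℝ}
    (ha : ∀ ω x, |U (({j} : Set ι).piecewise ω x) - c x| ≤ a) :
    ((Measure.infinitePi ν).tilted U).map (Function.eval j)
      ≤ ENNReal.ofReal (Real.exp (2 * a)) • ν j := by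
  have := hU.isProbabilityMeasure_tilted (Measure.infinitePi ν)
  have h_eval := measurePreserving_eval_infinitePi ν j
  refine Measure.le_iff.2 fun S hS => ?_
  set S' : Set (∀ i, E i) := Function.eval j ⁻¹' S
  have hS' : MeasurableSet S' := measurable_pi_apply j hS
  have hf : BddMeasurable (S'.indicator 1) :=
    ⟨measurable_one.indicator hS', 1, fun x => by by_cases hx : x ∈ S' <;> simp [hx]⟩
  have hfj : DependsOn (S'.indicator (1 : (∀ i, E i) → ℝ)) {j} := fun x y hxy => by
    have : x ∈ S' ↔ y ∈ S' := by simp only [S', mem_preimage, Function.eval, hxy j rfl]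
    by_cases hy : y ∈ S' <;> simp [this, hy]
  have h_cond (x : ∀ i, E i) : gibbsCondExp ν {j} U (S'.indicator 1) x
      ≤ Real.exp (2 * a) * (ν j).real S := by
    rw [gibbsCondExp_of_dependsOn ν _ hfj, integral_indicator_one hS',
      ← h_eval.measureReal_preimage hS.nullMeasurableSet]
    have := ENNReal.toReal_mono (by simp; finiteness) (tilted_le_exp_smul (Measure.infinitePi ν)
      (hU.comp (measurable_piecewise_left {j} x)) (fun ω => ha ω x) S')
    simpa [measureReal_def, (Real.exp_pos _).le] using this
  rw [Measure.map_apply (measurable_pi_apply j) hS, Measure.smul_apply, smul_eq_mul,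
    ← ofReal_measureReal, ← ofReal_measureReal (μ := ν j), ← ENNReal.ofReal_mul (Real.exp_pos _).le,
    ← integral_indicator_one hS', ← integral_gibbsCondExp ν {j} hU hf]
  refine ENNReal.ofReal_le_ofReal ?_
  simpa using integral_mono (μ := (Measure.infinitePi ν).tilted U)
    ((bddMeasurable_gibbsCondExp ν {j} hU hf).integrable _) (integrable_const _) h_cond

variable {Φ : ℕ → ℝ → ℝ} {b₀ s : ℝ}

lemma CrossBound.abs_hamiltonian_piecewise_singleton_sub_le (hΦ : IsInteraction Φ b₀ s) {K : ℝ}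
    (hK : CrossBound Φ 0 K) {A B j : ℤ} (hA : A ≤ j) (hB : j + 1 ≤ B) (ω x : ℤ → ℝ) :
    |hamiltonian Φ A B (({j} : Set ℤ).piecewise ω x)
      - (hamiltonian Φ A j x + hamiltonian Φ (j + 1) B x)| ≤ 2 * K := by
  set y := ({j} : Set ℤ).piecewise ω x
  have hy (i : ℤ) (hi : i ≠ j) : y i = x i := piecewise_eq_of_notMem _ _ _ hi
  have left : hamiltonian Φ A j y = hamiltonian Φ A j x :=
    dependsOn_hamiltonian Φ A j fun i hi => hy i hi.2.ne
  have right : hamiltonian Φ (j + 1) B y = hamiltonian Φ (j + 1) B x :=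
    dependsOn_hamiltonian Φ (j + 1) B fun i hi => hy i (by rw [mem_Ico] at hi; omega)
  have middle : hamiltonian Φ j (j + 1) y = 0 := by
    unfold hamiltonian crossEnergy
    exact Finset.sum_eq_zero fun i hi => Finset.sum_eq_zero fun l hl =>
      hΦ.interactionTerm_eq_zero (by simp only [Finset.mem_Ico] at hi hl; omega) y
  rw [hΦ.hamiltonian_eq_add hA (by omega), hΦ.hamiltonian_eq_add (by omega) hB, left, right, middle]
  have h_left := abs_le.1 (hK A j B y)
  have h_right := abs_le.1 (hK j (j + 1) B y)
  simp only [Nat.cast_zero, add_zero] at h_left h_right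
  rw [abs_le]
  constructor <;> linarith [h_left.1, h_left.2, h_right.1, h_right.2]

variable (ν : Measure ℝ) [IsProbabilityMeasure ν]

lemma CrossBound.map_eval_volGibbs_le (hΦ : IsInteraction Φ b₀ s) {K : ℝ}
    (hK : CrossBound Φ 0 K) (A B j : ℤ) :
    (volGibbs ν Φ A B).map (Function.eval j) ≤ ENNReal.ofReal (Real.exp (2 * (2 * K))) • ν := by
  have hH := hΦ.bddMeasurable_hamiltonian A B
  by_cases hj : A ≤ j ∧ j + 1 ≤ B
  · exact tilted_infinitePi_map_eval_le (fun _ => ν) hH j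
      (hK.abs_hamiltonian_piecewise_singleton_sub_le hΦ hj.1 hj.2)
  · refine tilted_infinitePi_map_eval_le (fun _ => ν) (c := hamiltonian Φ A B) hH j fun ω x => ?_
    rw [dependsOn_hamiltonian Φ A B fun i hi => piecewise_eq_of_notMem _ ω x ?_]
    · simpa using hK.nonneg
    · rintro rfl
      rw [mem_Ico] at hi
      omega

lemma isTightMeasureSet_range_volGibbs (hΦ : IsInteraction Φ b₀ s) (hs : 2 < s) :
    IsTightMeasureSet (range fun V : ℤ × ℤ => volGibbs ν Φ V.1 V.2) := by
  refine isTightMeasureSet_pi fun j => ?_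
  have hK := hΦ.crossBound hs 0
  set C : ℝ := Real.exp (2 * (2 * (b₀ * decayConst s * (((0 : ℕ) : ℝ) + 1) ^ (2 - s))))
  have := Measure.smul_finite ν (ENNReal.ofReal_ne_top (r := C))
  refine (isTightMeasureSet_setOf_le
    (isTightMeasureSet_singleton (μ := ENNReal.ofReal C • ν))).subset ?_
  rintro _ ⟨_, ⟨V, rfl⟩, rfl⟩
  exact hK.map_eval_volGibbs_le ν hΦ V.1 V.2 j

lemma IsInteraction.exists_memoryRate_le (hΦ : IsInteraction Φ b₀ s) (hs : 2 < s) {K : ℝ}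
    (hK : 0 ≤ K) {ε : ℝ} (hε : 0 < ε) :
    ∃ (q L : ℕ) (κ : ℝ), CrossBound Φ L κ ∧ memoryRate K κ (q + 1) ≤ ε := by
  have h_pow : Tendsto (fun q : ℕ => (1 - Real.exp (-(4 * K))) ^ (q + 1)) atTop (𝓝 0) :=
    (tendsto_pow_atTop_nhds_zero_of_lt_one (one_sub_exp_neg_nonneg (by positivity))
      (by linarith [Real.exp_pos (-(4 * K))])).comp (tendsto_add_atTop_nat 1)
  have h_decay : Tendsto (fun L : ℕ => ((L : ℝ) + 1) ^ (2 - s)) atTop (𝓝 0) := by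
    simpa [Function.comp_def] using (tendsto_rpow_neg_atTop (sub_pos.2 hs)).comp
      ((tendsto_natCast_atTop_atTop (R := ℝ)).comp (tendsto_add_atTop_nat 1))
  have h_far : Tendsto (fun L : ℕ => Real.exp (4 * K) *
      (1 - Real.exp (-(4 * (b₀ * decayConst s * ((L : ℝ) + 1) ^ (2 - s)))))) atTop (𝓝 0) := by
    have h_cont : Continuous fun t : ℝ =>
      Real.exp (4 * K) * (1 - Real.exp (-(4 * (b₀ * decayConst s * t)))) := by fun_prop
    simpa [Function.comp_def] using (h_cont.tendsto 0).comp h_decay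
  obtain ⟨q, hq⟩ := (h_pow.eventually_lt_const (half_pos hε)).exists
  obtain ⟨L, hL⟩ := (h_far.eventually_lt_const (half_pos hε)).exists
  exact ⟨q, L, _, hΦ.crossBound hs L, by rw [memoryRate]; linarith⟩

lemma eventually_abs_integral_volGibbs_sub_le (hΦ : IsInteraction Φ b₀ s) (hs : 2 < s) {a b : ℤ}
    (hab : a ≤ b) {M ε : ℝ} (hM0 : 0 < M) (hε : 0 < ε) :
    ∀ᶠ p : (ℤ × ℤ) × (ℤ × ℤ) in (atBot ×ˢ atTop) ×ˢ (atBot ×ˢ atTop), ∀ f : (ℤ → ℝ) → ℝ,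
      BddMeasurable f → DependsOn f (Ico a b) → (∀ ω, |f ω| ≤ M) →
      |∫ ω, f ω ∂(volGibbs ν Φ p.1.1 p.1.2) - ∫ ω, f ω ∂(volGibbs ν Φ p.2.1 p.2.2)| ≤ ε := by
  have hK := hΦ.crossBound hs 0
  obtain ⟨q, L, κ, hκ, hle⟩ := hΦ.exists_memoryRate_le hs hK.nonneg (ε := ε / (4 * M))
    (by positivity)
  have hV : ∀ᶠ V : ℤ × ℤ in atBot ×ˢ atTop, V.1 ≤ a - q * L ∧ b + q * L ≤ V.2 :=
    (eventually_le_atBot _).prod_mk (eventually_ge_atTop _)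
  filter_upwards [hV.prod_mk hV] with p hp f hf hfab hM
  calc _ ≤ 2 * (memoryRate _ κ (q + 1) * (2 * M)) :=
        abs_integral_volGibbs_sub_le ν hΦ hK hκ q hab hp.1.1 hp.2.1 hp.1.2 hp.2.2 hf hfab
          fun x y => (abs_sub _ _).trans (by linarith [hM x, hM y])
    _ ≤ 2 * (ε / (4 * M) * (2 * M)) := by gcongr
    _ = ε := by field_simp; ring

/-- `μ` is the limit of the Gibbs measures of finite chains whose ends tend to infinity, in the
sense of convergence of the expectations of bounded measurable local observables. -/
def IsThermodynamicLimit (ν : Measure ℝ) (Φ : ℕ → ℝ → ℝ) (μ : Measure (ℤ → ℝ)) : Prop :=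
  ∀ (k : ℕ) (a : ℤ) (h : (Fin k → ℝ) → ℝ), BddMeasurable h →
    Tendsto (fun V : ℤ × ℤ => ∫ ω, h (window k a ω) ∂(volGibbs ν Φ V.1 V.2)) (atBot ×ˢ atTop)
      (𝓝 (∫ ω, h (window k a ω) ∂μ))

lemma dependsOn_window (k : ℕ) (a : ℤ) : DependsOn (window k a) (Ico a (a + k)) :=
  fun _ _ h => funext fun l => h _ (by rw [mem_Ico]; omega)

lemma continuous_window (k : ℕ) (a : ℤ) : Continuous (window k a) :=
  continuous_pi fun _ => continuous_apply _

lemma exists_isThermodynamicLimit (hΦ : IsInteraction Φ b₀ s) (hs : 2 < s) :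
    ∃ μ : Measure (ℤ → ℝ), IsProbabilityMeasure μ ∧ IsThermodynamicLimit ν Φ μ := by
  let Q (V : ℤ × ℤ) : ProbabilityMeasure (ℤ → ℝ) :=
    ⟨volGibbs ν Φ V.1 V.2, hΦ.isProbabilityMeasure_volGibbs ν V.1 V.2⟩
  have h_compact : IsCompact (closure (range Q)) := by
    refine isCompact_closure_of_isTightMeasureSet ?_
    refine (isTightMeasureSet_range_volGibbs ν hΦ hs).subset ?_
    rintro _ ⟨_, ⟨V, rfl⟩, rfl⟩
    exact ⟨V, rfl⟩
  let u : Ultrafilter (ℤ × ℤ) := .of (atBot ×ˢ atTop)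
  obtain ⟨μ, -, hμ⟩ := h_compact.ultrafilter_le_nhds (u.map Q)
    (le_principal_iff.2 <| Ultrafilter.mem_map.2 <| univ_mem' fun V => subset_closure ⟨V, rfl⟩)
  refine ⟨μ, inferInstance, fun k a h hh => ?_⟩
  have hw := continuous_window k a
  have h_map (P : ProbabilityMeasure (ℤ → ℝ)) {g : (Fin k → ℝ) → ℝ} (hg : BddMeasurable g) :
      ∫ x, g x ∂(P.map hw.measurable.aemeasurable : Measure (Fin k → ℝ))
        = ∫ ω, g (window k a ω) ∂(P : Measure (ℤ → ℝ)) :=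
    integral_map hw.measurable.aemeasurable hg.measurable.aestronglyMeasurable
  simp only [← h_map μ hh]
  refine (tendsto_integral_of_tendsto_of_eventually_abs_sub_le (Ultrafilter.of_le _)
    (ProbabilityMeasure.tendsto_map_of_tendsto_of_continuous Q μ hμ hw)
    (fun M hM ε hε => ?_) hh).congr fun V => h_map (Q V) hh
  filter_upwards [eventually_abs_integral_volGibbs_sub_le ν hΦ hs (by omega : a ≤ a + k) hM hε]
    with p hp g hg hgM
  rw [h_map (Q p.1) hg, h_map (Q p.2) hg]
  exact hp _ (hg.comp hw.measurable) (fun x y hxy => congrArg g (dependsOn_window k a hxy))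
    fun ω => hgM _

end ThermodynamicLimit

section TiltedProducts

lemma inv_univ_smul_withDensity_exp {Ω : Type*} [MeasurableSpace Ω] {P : Measure Ω} {U : Ω → ℝ}
    (hU : Integrable (fun x => Real.exp (U x)) P) :
    ((P.withDensity fun x => ENNReal.ofReal (Real.exp (U x))) univ)⁻¹ •
      (P.withDensity fun x => ENNReal.ofReal (Real.exp (U x))) = P.tilted U := by
  rcases eq_zero_or_neZero P with rfl | hP
  · simp
  have hpos := integral_exp_pos hU
  rw [withDensity_apply _ MeasurableSet.univ, setLIntegral_univ,
    ← ofReal_integral_eq_lintegral_ofReal hU (ae_of_all _ fun _ => (Real.exp_pos _).le),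
    Measure.tilted, ← withDensity_smul' _ _ (by simp [hpos])]
  congr 1 with x
  rw [Pi.smul_apply, smul_eq_mul, ENNReal.ofReal_div_of_pos hpos, div_eq_mul_inv, mul_comm]

variable {ι : Type*} [Fintype ι] {α : ι → Type*} [∀ i, MeasurableSpace (α i)]
  {ρ : ∀ i, Measure (α i)} [∀ i, SigmaFinite (ρ i)] {g : ∀ i, α i → ℝ}

lemma integrable_exp_sum_pi (hg : ∀ i, Integrable (fun x => Real.exp (g i x)) (ρ i)) :
    Integrable (fun z : ∀ i, α i => Real.exp (∑ i, g i (z i))) (Measure.pi ρ) := by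
  simp_rw [Real.exp_sum]
  exact Integrable.fintype_prod_dep hg

lemma pi_tilted [∀ i, SigmaFinite ((ρ i).tilted (g i))] :
    Measure.pi (fun i => (ρ i).tilted (g i))
      = (Measure.pi ρ).tilted fun z => ∑ i, g i (z i) := by
  refine Measure.pi_eq fun t _ => ?_
  have h_mass : ∫ z, Real.exp (∑ i, g i (z i)) ∂(Measure.pi ρ)
      = ∏ i, ∫ x, Real.exp (g i x) ∂(ρ i) := by
    simp_rw [Real.exp_sum]
    exact integral_fintype_prod_eq_prod fun i x => Real.exp (g i x)
  simp_rw [tilted_apply_eq_ofReal_integral, h_mass, Real.exp_sum, ← Finset.prod_div_distrib]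
  rw [Measure.restrict_pi_pi, integral_fintype_prod_eq_prod
    (fun i x => Real.exp (g i x) / ∫ x, Real.exp (g i x) ∂(ρ i)), ENNReal.ofReal_prod_of_nonneg]
  exact fun i _ => integral_nonneg fun x => div_nonneg (Real.exp_pos _).le
    (integral_nonneg fun y => (Real.exp_pos _).le)

end TiltedProducts

section ERealSums

variable {ι : Type*} {S : Finset ι} {f : ι → EReal}

lemma ereal_coe_sum (S : Finset ι) (f : ι → ℝ) :
    ((∑ i ∈ S, f i : ℝ) : EReal) = ∑ i ∈ S, (f i : EReal) :=
  map_sum (⟨⟨Real.toEReal, EReal.coe_zero⟩, EReal.coe_add⟩ : ℝ →+ EReal) f S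

lemma ereal_sum_ne_bot (h : ∀ i ∈ S, f i ≠ ⊥) : ∑ i ∈ S, f i ≠ ⊥ :=
  Finset.sum_induction f (· ≠ ⊥) (fun _ _ ha hb => EReal.add_ne_bot_iff.2 ⟨ha, hb⟩)
    EReal.zero_ne_bot h

lemma ereal_sum_eq_top (h : ∀ i ∈ S, f i ≠ ⊥) {i : ι} (hi : i ∈ S) (hf : f i = ⊤) :
    ∑ i ∈ S, f i = ⊤ := by
  classical
  rw [← Finset.add_sum_erase S f hi, hf]
  exact EReal.top_add_of_ne_bot (ereal_sum_ne_bot fun j hj => h j (Finset.mem_of_mem_erase hj))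

end ERealSums

section PairPotential

/-- A pair potential with hard core radius `rhc` that is bounded below by `-b r ^ (-s)` outside
the core, and above by `b r ^ (-s)` at the distances `r > 2 rhc` of particles that are not nearest
neighbours. -/
structure IsHardCoreDecaying (v : ℝ → EReal) (rhc b s : ℝ) : Prop where
  rhc_pos : 0 < rhc
  b_pos : 0 < b
  two_lt_s : 2 < s
  eq_top : ∀ r, 0 < r → r ≤ rhc → v r = ⊤
  ne_top : ∀ r, rhc < r → v r ≠ ⊤
  ne_bot : ∀ r, rhc < r → v r ≠ ⊥
  measurable : Measurable ((Ioi rhc).indicator (realPart v))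
  le_realPart : ∀ r, rhc < r → -(b * r ^ (-s)) ≤ realPart v r
  realPart_le : ∀ r, 2 * rhc < r → realPart v r ≤ b * r ^ (-s)

/-- The reduced interaction through `n ≥ 2` spacings of total length `r`; it is set to `0` for the
lengths `r ≤ n rhc` that the hard core excludes. -/
def chainInteraction (v : ℝ → EReal) (rhc : ℝ) (m : ℕ∞) (β : ℝ) (n : ℕ) (r : ℝ) : ℝ :=
  if 2 ≤ n ∧ (n : ℕ∞) ≤ m then (Ioi (n * rhc)).indicator (fun r => -(β * realPart v r)) r else 0

/-- The law of a spacing `z` in a chain without interactions beyond nearest neighbours, with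
density proportional to `exp (-β (v z + p z))`. -/
def siteMeasure (v : ℝ → EReal) (rhc β p : ℝ) : Measure ℝ :=
  (volume.restrict (Ioi rhc)).tilted fun z => -(β * (realPart v z + p * z))

lemma ae_lt_siteMeasure (v : ℝ → EReal) (rhc β p : ℝ) :
    ∀ᵐ z ∂(siteMeasure v rhc β p), rhc < z :=
  (tilted_absolutelyContinuous _ _).ae_le (ae_restrict_mem measurableSet_Ioi)

namespace IsHardCoreDecaying

variable {v : ℝ → EReal} {rhc b s : ℝ} (hv : IsHardCoreDecaying v rhc b s)

include hv

lemma coe_realPart {r : ℝ} (hr : rhc < r) : (realPart v r : EReal) = v r :=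
  EReal.coe_toReal (hv.ne_top r hr) (hv.ne_bot r hr)

lemma ne_bot_of_pos {r : ℝ} (hr : 0 < r) : v r ≠ ⊥ := by
  rcases le_or_gt r rhc with h | h
  · simp [hv.eq_top r hr h]
  · exact hv.ne_bot r h

lemma abs_realPart_le {n : ℕ} (hn : 2 ≤ n) {r : ℝ} (hr : n * rhc < r) :
    |realPart v r| ≤ b * rhc ^ (-s) * (n : ℝ) ^ (-s) := by
  have hrhc := hv.rhc_pos
  have hs := hv.two_lt_s
  have hn' : (2 : ℝ) ≤ n := by exact_mod_cast hn
  have h2r : 2 * rhc < r := hr.trans_le' (by gcongr)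
  calc |realPart v r| ≤ b * r ^ (-s) :=
        abs_le.2 ⟨hv.le_realPart r (by linarith), hv.realPart_le r h2r⟩
    _ ≤ b * (n * rhc) ^ (-s) := mul_le_mul_of_nonneg_left
        (Real.rpow_le_rpow_of_nonpos (by positivity) hr.le (by linarith)) hv.b_pos.le
    _ = b * rhc ^ (-s) * (n : ℝ) ^ (-s) := by
        rw [Real.mul_rpow (by positivity) hrhc.le]
        ring

lemma measurable_indicator {a : ℝ} (ha : rhc ≤ a) :
    Measurable ((Ioi a).indicator (realPart v)) := by
  simpa [indicator_indicator, Ioi_inter_Ioi, max_eq_left ha] using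
    hv.measurable.indicator (measurableSet_Ioi (a := a))

lemma isInteraction (m : ℕ∞) {β : ℝ} (hβ : 0 < β) :
    IsInteraction (chainInteraction v rhc m β) (β * (b * rhc ^ (-s))) s where
  measurable n := by
    unfold chainInteraction
    split_ifs with h
    · have hn : (2 : ℝ) ≤ n := by exact_mod_cast h.1
      have := hv.measurable_indicator (a := n * rhc) (by nlinarith [hv.rhc_pos])
      simpa only [indicator_neg, indicator_const_mul, Pi.neg_def] using (this.const_mul β).neg
    · exact measurable_const
  eq_zero_of_le_one n r hn := if_neg (by omega)
  abs_le n r := by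
    have hb := hv.b_pos
    have hrhc := hv.rhc_pos
    unfold chainInteraction
    split_ifs with h
    · by_cases hr : n * rhc < r
      · rw [indicator_of_mem (mem_Ioi.2 hr), abs_neg, abs_mul, abs_of_pos hβ, mul_assoc]
        exact mul_le_mul_of_nonneg_left (hv.abs_realPart_le h.1 hr) hβ.le
      · rw [indicator_of_notMem (notMem_Ioi.2 (not_lt.1 hr)), abs_zero]
        positivity
    · rw [abs_zero]
      positivity

lemma integrable_exp_site {β p : ℝ} (hβ : 0 < β) (hp : 0 < p) :
    Integrable (fun z => Real.exp (-(β * (realPart v z + p * z))))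
      (volume.restrict (Ioi rhc)) := by
  have hs := hv.two_lt_s
  refine ((exp_neg_integrableOn_Ioi rhc (mul_pos hβ hp)).const_mul
    (Real.exp (β * (b * rhc ^ (-s))))).mono' ?_ ?_
  · have := (aemeasurable_indicator_iff (μ := volume) measurableSet_Ioi).1
      hv.measurable.aemeasurable
    exact (by fun_prop : AEMeasurable (fun z => Real.exp (-(β * (realPart v z + p * z))))
      (volume.restrict (Ioi rhc))).aestronglyMeasurable
  · filter_upwards [ae_restrict_mem measurableSet_Ioi] with z hz
    have h_lower : -(b * rhc ^ (-s)) ≤ realPart v z :=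
      (neg_le_neg (mul_le_mul_of_nonneg_left (Real.rpow_le_rpow_of_nonpos hv.rhc_pos
        (le_of_lt hz) (by linarith)) hv.b_pos.le)).trans (hv.le_realPart z hz)
    rw [Real.norm_eq_abs, Real.abs_exp, ← Real.exp_add]
    exact Real.exp_le_exp.2 (by nlinarith)

lemma isProbabilityMeasure_siteMeasure {β p : ℝ} (hβ : 0 < β) (hp : 0 < p) :
    IsProbabilityMeasure (siteMeasure v rhc β p) := by
  have : NeZero ((volume : Measure ℝ).restrict (Ioi rhc)) := ⟨by simp⟩
  exact isProbabilityMeasure_tilted (hv.integrable_exp_site hβ hp)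

end IsHardCoreDecaying

namespace IsLennardJonesType

variable {v : ℝ → EReal} {rhc zmin zmax α₁ α₂ s : ℝ}
  (hv : IsLennardJonesType v rhc zmin zmax α₁ α₂ s)

include hv

lemma coe_realPart {r : ℝ} (hr : rhc < r) : (realPart v r : EReal) = v r :=
  EReal.coe_toReal (hv.ne_top r hr) (hv.ne_bot r hr)

lemma neg_mul_rpow_le_realPart (hrhc : 0 < rhc) {r : ℝ} (hr : rhc < r) :
    -α₁ * r ^ (-s) ≤ realPart v r :=
  EReal.coe_le_coe_iff.1 ((hv.lower_bound r (hrhc.trans hr)).trans_eq (hv.coe_realPart hr).symm)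

lemma realPart_le_of_le (hrhc : 0 < rhc) {r₀ r : ℝ} (hr₀ : rhc < r₀) (h : r₀ ≤ r)
    (hr : r ≤ zmax) :
    realPart v r ≤ realPart v r₀ := by
  rw [← EReal.coe_le_coe_iff, hv.coe_realPart (hr₀.trans_le h), hv.coe_realPart hr₀]
  rcases hr.eq_or_lt with rfl | h_lt
  · rcases h.eq_or_lt with rfl | h'
    · exact le_rfl
    · exact (hv.unique_min _ (hrhc.trans hr₀) h'.ne).le
  · exact hv.antitoneOn ⟨hrhc.trans hr₀, h.trans_lt h_lt⟩ ⟨hrhc.trans (hr₀.trans_le h), h_lt⟩ h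

lemma realPart_le_mul_rpow (hrhc : 0 < rhc) {r₀ r : ℝ} (hr₀ : rhc < r₀) (hr : r₀ ≤ r) :
    realPart v r ≤ |realPart v r₀| * zmax ^ s * r ^ (-s) := by
  have hr_pos : 0 < r := hrhc.trans (hr₀.trans_le hr)
  rcases lt_or_ge zmax r with h | h
  · have hzmax : 0 ≤ zmax ^ s * r ^ (-s) := by
      have : 0 < zmax := hrhc.trans (hv.rhc_lt_zmin.trans hv.zmin_lt_zmax)
      positivity
    have h_nonpos : realPart v r ≤ 0 :=
      EReal.coe_nonpos.1 ((hv.coe_realPart (hr₀.trans_le hr)).trans_le (hv.nonpos r h))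
    rw [mul_assoc]
    exact h_nonpos.trans (mul_nonneg (abs_nonneg _) hzmax)
  · have h_ratio : 1 ≤ zmax ^ s * r ^ (-s) := by
      rw [Real.rpow_neg hr_pos.le, ← div_eq_mul_inv,
        ← Real.div_rpow (hr_pos.le.trans h) hr_pos.le]
      exact Real.one_le_rpow ((one_le_div hr_pos).2 h) (by linarith [hv.two_lt_s])
    rw [mul_assoc]
    exact (hv.realPart_le_of_le hrhc hr₀ hr h).trans
      ((le_abs_self _).trans (le_mul_of_one_le_right (abs_nonneg _) h_ratio))

lemma exists_isHardCoreDecaying (hrhc : 0 < rhc) : ∃ b, IsHardCoreDecaying v rhc b s := by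
  have hα := hv.α₁_pos
  have hzmax : 0 < zmax := hrhc.trans (hv.rhc_lt_zmin.trans hv.zmin_lt_zmax)
  set D := |realPart v (2 * rhc)| * zmax ^ s
  have h_meas : Measurable ((Ioi rhc).indicator (realPart v)) := by
    classical
    rw [← piecewise_eq_indicator]
    exact hv.contDiffOn.continuousOn.measurable_piecewise continuousOn_const measurableSet_Ioi
  refine ⟨α₁ + D, hrhc, by positivity, hv.two_lt_s, hv.eq_top, hv.ne_top, hv.ne_bot, h_meas,
    fun r hr => ?_, fun r hr => ?_⟩
  · have : 0 ≤ D * r ^ (-s) := mul_nonneg (by positivity) (Real.rpow_nonneg (hrhc.trans hr).le _)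
    linarith [hv.neg_mul_rpow_le_realPart hrhc hr]
  · have : 0 ≤ α₁ * r ^ (-s) := mul_nonneg hα.le (Real.rpow_nonneg (by linarith) _)
    have : realPart v r ≤ D * r ^ (-s) :=
      hv.realPart_le_mul_rpow hrhc (by linarith) hr.le
    linarith

end IsLennardJonesType

end PairPotential

section FiniteChains

/-- The total interaction of a chain with `M` spacings; it is `hamiltonian Φ 0 M` as a function of
the spacings of the finite chain. -/
def chainHamiltonian (Φ : ℕ → ℝ → ℝ) {M : ℕ} (z : Fin M → ℝ) : ℝ :=
  ∑ i : Fin M, ∑ j : Fin M, Φ ((j : ℕ) + 1 - i) (∑ l ∈ Finset.Icc i j, z l)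

lemma sum_Ico_zero_eq_sum_fin (M : ℕ) (f : ℤ → ℝ) :
    ∑ i ∈ Finset.Ico (0 : ℤ) M, f i = ∑ i : Fin M, f (i : ℕ) := by
  rw [Fin.sum_univ_eq_sum_range (fun i => f i), ← Finset.sum_image (g := fun i : ℕ => (i : ℤ))
    (Nat.cast_injective.injOn)]
  congr 1
  ext i
  simp only [Finset.mem_Ico, Finset.mem_image, Finset.mem_range]
  exact ⟨fun h => ⟨i.toNat, by omega, by omega⟩, by rintro ⟨j, hj, rfl⟩; omega⟩

lemma sum_Icc_fin_eq {M : ℕ} (i j : Fin M) (f : ℤ → ℝ) :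
    ∑ l ∈ Finset.Icc i j, f (l : ℕ) = ∑ l ∈ Finset.Icc ((i : ℕ) : ℤ) (j : ℕ), f l := by
  have h_nat : ∑ l ∈ Finset.Icc i j, f (l : ℕ) = ∑ l ∈ Finset.Icc (i : ℕ) j, f l := by
    rw [← Fin.map_valEmbedding_Icc, Finset.sum_map]
    rfl
  rw [h_nat, ← Finset.sum_image (g := fun i : ℕ => (i : ℤ)) (Nat.cast_injective.injOn)]
  congr 1
  ext l
  simp only [Finset.mem_Icc, Finset.mem_image]
  exact ⟨by rintro ⟨n, hn, rfl⟩; omega, fun h => ⟨l.toNat, by omega, by omega⟩⟩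

lemma chainHamiltonian_window (Φ : ℕ → ℝ → ℝ) (M : ℕ) (ω : ℤ → ℝ) :
    chainHamiltonian Φ (window M 0 ω) = hamiltonian Φ 0 M ω := by
  simp only [chainHamiltonian, hamiltonian, crossEnergy, sum_Ico_zero_eq_sum_fin, interactionTerm,
    ← sum_Icc_fin_eq, window, zero_add]
  congr! 4
  omega

lemma IsInteraction.bddMeasurable_chainHamiltonian {Φ : ℕ → ℝ → ℝ} {b₀ s : ℝ}
    (hΦ : IsInteraction Φ b₀ s) (M : ℕ) :
    BddMeasurable (chainHamiltonian Φ : (Fin M → ℝ) → ℝ) :=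
  .sum _ fun _ _ => .sum _ fun _ _ =>
    ⟨(hΦ.measurable _).comp (Finset.measurable_sum _ fun l _ => measurable_pi_apply l), _,
      fun _ => hΦ.abs_le _ _⟩

lemma measurePreserving_window_infinitePi (ν : Measure ℝ) [IsProbabilityMeasure ν] (k : ℕ) (a : ℤ) :
    MeasurePreserving (window k a) (Measure.infinitePi fun _ => ν)
      (Measure.pi fun _ : Fin k => ν) := by
  refine ⟨(continuous_window k a).measurable, ?_⟩
  rw [← Measure.infinitePi_eq_pi]
  exact Measure.map_infinitePi_infinitePi_of_inj (f := fun l : Fin k => a + ((l : ℕ) : ℤ))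
    fun l l' h => Fin.ext (by simpa using h)

lemma IsInteraction.measurePreserving_window_volGibbs {Φ : ℕ → ℝ → ℝ} {b₀ s : ℝ}
    (hΦ : IsInteraction Φ b₀ s) (ν : Measure ℝ) [IsProbabilityMeasure ν] (M : ℕ) :
    MeasurePreserving (window M 0) (volGibbs ν Φ 0 M)
      ((Measure.pi fun _ : Fin M => ν).tilted (chainHamiltonian Φ)) := by
  simpa only [volGibbs, chainHamiltonian_window] using
    measurePreserving_tilted (measurePreserving_window_infinitePi ν M 0)
      (hΦ.bddMeasurable_chainHamiltonian M).measurable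

lemma card_mul_lt_sum_Icc {rhc : ℝ} {M : ℕ} {z : Fin M → ℝ} (hz : ∀ i, rhc < z i) {i j : Fin M}
    (hij : i ≤ j) : (((j : ℕ) + 1 - i : ℕ) : ℝ) * rhc < ∑ l ∈ Finset.Icc i j, z l := by
  rw [← Fin.card_Icc, ← nsmul_eq_mul, ← Finset.sum_const]
  exact Finset.sum_lt_sum_of_nonempty (Finset.nonempty_Icc.2 hij) fun l _ => hz l

lemma sum_chainInteraction (v : ℝ → EReal) {m : ℕ∞} (hm : 1 ≤ m) (β : ℝ) {rhc : ℝ} {M : ℕ}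
    {z : Fin M → ℝ} (hz : ∀ i, rhc < z i) (i : Fin M) :
    ∑ j : Fin M, chainInteraction v rhc m β ((j : ℕ) + 1 - i) (∑ l ∈ Finset.Icc i j, z l)
      = β * realPart v (z i) - β * ∑ j ∈ Finset.Ici i, (if ((Finset.Icc i j).card : ℕ∞) ≤ m
          then realPart v (∑ l ∈ Finset.Icc i j, z l) else 0) := by
  have h_pair (j : Fin M) (hj : j ∈ Finset.Ioi i) : chainInteraction v rhc m β ((j : ℕ) + 1 - i)
      (∑ l ∈ Finset.Icc i j, z l) = -(β * if ((Finset.Icc i j).card : ℕ∞) ≤ m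
        then realPart v (∑ l ∈ Finset.Icc i j, z l) else 0) := by
    have hij : (i : ℕ) < j := Fin.lt_def.1 (Finset.mem_Ioi.1 hj)
    have hn : 2 ≤ (j : ℕ) + 1 - i := by omega
    rw [chainInteraction, indicator_of_mem (mem_Ioi.2 (card_mul_lt_sum_Icc hz hij.le)),
      Fin.card_Icc]
    simp only [hn, true_and, mul_ite, mul_zero, neg_ite, neg_zero]
  rw [Finset.Ici_eq_cons_Ioi, Finset.sum_cons, ← Finset.sum_subset (Finset.subset_univ
    (Finset.Ioi i)), Finset.sum_congr rfl h_pair, Finset.sum_neg_distrib, ← Finset.mul_sum]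
  · simp [hm, mul_add]
  · intro j _ hj
    have hij : (j : ℕ) ≤ i := Fin.le_def.1 (not_lt.1 fun h => hj (Finset.mem_Ioi.2 h))
    exact if_neg (by omega)

lemma measurableSet_posOrthant (k : ℕ) : MeasurableSet (posOrthant k) := by
  simp only [posOrthant]
  measurability

end FiniteChains

namespace IsHardCoreDecaying

variable {v : ℝ → EReal} {rhc b s : ℝ} (hv : IsHardCoreDecaying v rhc b s) {m : ℕ∞} {M : ℕ}
  {z : Fin M → ℝ}

include hv

lemma energy_eq_top (hm : 1 ≤ m) (p : ℝ) (hz : ∀ i, 0 < z i) {i : Fin M} (hi : z i ≤ rhc) :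
    energy v m p z = ⊤ := by
  have h_term (a b : Fin M) (hab : b ∈ Finset.Ici a) : (if ((Finset.Icc a b).card : ℕ∞) ≤ m
      then v (∑ l ∈ Finset.Icc a b, z l) else 0) ≠ ⊥ := by
    split_ifs
    · exact hv.ne_bot_of_pos (Finset.sum_pos (fun l _ => hz l)
        (Finset.nonempty_Icc.2 (Finset.mem_Ici.1 hab)))
    · exact EReal.zero_ne_bot
  rw [energy, ereal_sum_eq_top (fun a _ => ereal_sum_ne_bot (h_term a)) (Finset.mem_univ i),
    EReal.top_add_coe]
  refine ereal_sum_eq_top (h_term i) (Finset.mem_Ici.2 le_rfl) ?_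
  simpa [hm] using hv.eq_top _ (hz i) hi

lemma energy_eq_coe (p : ℝ) (hz : ∀ i, rhc < z i) :
    energy v m p z = ((∑ i : Fin M, ∑ j ∈ Finset.Ici i,
      (if ((Finset.Icc i j).card : ℕ∞) ≤ m then realPart v (∑ l ∈ Finset.Icc i j, z l) else 0)
      + p * ∑ i, z i : ℝ) : EReal) := by
  simp only [energy, EReal.coe_add, ereal_coe_sum, apply_ite Real.toEReal, EReal.coe_zero]
  refine congrArg (· + _) (Finset.sum_congr rfl fun i _ => Finset.sum_congr rfl fun j hj => ?_)
  rw [hv.coe_realPart]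
  have hij := Finset.mem_Ici.1 hj
  calc rhc < z i := hz i
    _ ≤ ∑ l ∈ Finset.Icc i j, z l := Finset.single_le_sum (f := z)
        (fun l _ => (hv.rhc_pos.trans (hz l)).le) (Finset.left_mem_Icc.2 hij)

lemma neg_mul_energy (hm : 1 ≤ m) (β p : ℝ) (hz : ∀ i, rhc < z i) :
    -((β : EReal) * energy v m p z) = ((∑ i, -(β * (realPart v (z i) + p * z i))
      + chainHamiltonian (chainInteraction v rhc m β) z : ℝ) : EReal) := by
  rw [hv.energy_eq_coe p hz, ← EReal.coe_mul, ← EReal.coe_neg, EReal.coe_eq_coe_iff,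
    chainHamiltonian, Finset.sum_congr rfl fun i _ => sum_chainInteraction v hm β hz i]
  simp only [Finset.sum_sub_distrib, Finset.sum_neg_distrib, ← Finset.mul_sum,
    Finset.sum_add_distrib]
  ring

lemma gibbsWeight_eq_withDensity (hm : 1 ≤ m) {β : ℝ} (hβ : 0 < β) (p : ℝ) (M : ℕ) :
    gibbsWeight v m p β M = (Measure.pi fun _ : Fin M => volume.restrict (Ioi rhc)).withDensity
      fun z => ENNReal.ofReal (Real.exp (∑ i, -(β * (realPart v (z i) + p * z i))
        + chainHamiltonian (chainInteraction v rhc m β) z)) := by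
  have h_meas : MeasurableSet (Set.pi univ fun _ : Fin M => Ioi rhc) :=
    MeasurableSet.univ_pi fun _ => measurableSet_Ioi
  have h_subset : (Set.pi univ fun _ : Fin M => Ioi rhc) ⊆ posOrthant M := fun z hz i =>
    hv.rhc_pos.trans (hz i (mem_univ i))
  rw [← Measure.restrict_pi_pi, ← volume_pi, ← inter_eq_left.2 h_subset,
    ← Measure.restrict_restrict h_meas, ← withDensity_indicator h_meas, gibbsWeight]
  refine withDensity_congr_ae ?_
  filter_upwards [ae_restrict_mem (measurableSet_posOrthant M)] with z hz
  by_cases hzS : z ∈ Set.pi univ fun _ : Fin M => Ioi rhc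
  · rw [indicator_of_mem hzS, hv.neg_mul_energy hm β p fun i => hzS i (mem_univ i),
      EReal.exp_coe]
  · obtain ⟨i, hi⟩ : ∃ i, z i ≤ rhc := by simpa [Set.mem_pi] using hzS
    rw [indicator_of_notMem hzS, hv.energy_eq_top hm p hz hi, EReal.coe_mul_top_of_pos hβ,
      EReal.neg_top, EReal.exp_bot]

lemma finiteGibbs_eq_tilted (hm : 1 ≤ m) {p β : ℝ} (hβ : 0 < β) (hp : 0 < p) (M : ℕ) :
    finiteGibbs v m p β M = (Measure.pi fun _ : Fin M => siteMeasure v rhc β p).tilted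
      (chainHamiltonian (chainInteraction v rhc m β)) := by
  have : IsProbabilityMeasure ((volume.restrict (Ioi rhc)).tilted
    fun z => -(β * (realPart v z + p * z))) := hv.isProbabilityMeasure_siteMeasure hβ hp
  have h_site := integrable_exp_sum_pi fun _ : Fin M => hv.integrable_exp_site hβ hp
  have h_exp := ((hv.isInteraction m hβ).bddMeasurable_chainHamiltonian M).exp
  unfold siteMeasure
  rw [finiteGibbs, hv.gibbsWeight_eq_withDensity hm hβ p, inv_univ_smul_withDensity_exp, pi_tilted,
    tilted_tilted h_site]
  · rfl
  · obtain ⟨C, hC⟩ := h_exp.exists_abs_le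
    simp only [Real.exp_add]
    exact h_site.mul_bdd h_exp.measurable.aestronglyMeasurable (ae_of_all _ hC)

lemma measurePreserving_window_volGibbs (hm : 1 ≤ m) {p β : ℝ} (hβ : 0 < β) (hp : 0 < p) (M : ℕ) :
    MeasurePreserving (window M 0)
      (volGibbs (siteMeasure v rhc β p) (chainInteraction v rhc m β) 0 M)
      (finiteGibbs v m p β M) := by
  have := hv.isProbabilityMeasure_siteMeasure hβ hp
  rw [hv.finiteGibbs_eq_tilted hm hβ hp]
  exact (hv.isInteraction m hβ).measurePreserving_window_volGibbs _ M

end IsHardCoreDecaying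

section Correlations

variable {μ : Measure (ℤ → ℝ)} {k : ℕ} {f g : (Fin k → ℝ) → ℝ}

lemma correlation_eq_covariance [IsProbabilityMeasure μ] (hf : BddMeasurable f)
    (hg : BddMeasurable g) (n : ℕ) :
    correlation μ f g n = cov[fun z => f (window k 0 z), fun z => g (window k n z); μ] :=
  (covariance_eq_sub ((hf.comp (continuous_window k 0).measurable).memLp 2 μ)
    ((hg.comp (continuous_window k n).measurable).memLp 2 μ)).symm

lemma abs_correlation_le_mul [IsProbabilityMeasure μ] (hf : BddMeasurable f)
    (hg : BddMeasurable g) {F G : ℝ} (hF : ∀ x, |f x| ≤ F) (hG : ∀ x, |g x| ≤ G) (n : ℕ) :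
    |correlation μ f g n| ≤ F * G := by
  rw [correlation_eq_covariance hf hg]
  exact abs_covariance_le μ (hf.comp (continuous_window k 0).measurable)
    (hg.comp (continuous_window k n).measurable)
    (fun x y => (abs_sub _ _).trans (by linarith [hF (window k 0 x), hF (window k 0 y)]))
    fun x => hG _

lemma correlation_indicator_posOrthant (hμ : ∀ᵐ z ∂μ, ∀ j, 0 < z j) (n : ℕ) :
    correlation μ ((posOrthant k).indicator f) ((posOrthant k).indicator g) n
      = correlation μ f g n := by
  have h_indicator (h : (Fin k → ℝ) → ℝ) (a : ℤ) :
      (fun z => (posOrthant k).indicator h (window k a z)) =ᵐ[μ] fun z => h (window k a z) :=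
    hμ.mono fun z hz => indicator_of_mem (show window k a z ∈ posOrthant k from fun _ => hz _) h
  exact congrArg₂ _ (integral_congr_ae ((h_indicator f 0).mul (h_indicator g n)))
    (congrArg₂ _ (integral_congr_ae (h_indicator f 0)) (integral_congr_ae (h_indicator g n)))

lemma supNorm_nonneg (f : (Fin k → ℝ) → ℝ) : 0 ≤ supNorm f :=
  Real.iSup_nonneg fun _ => abs_nonneg _

lemma IsBoundedFun.abs_indicator_le_supNorm (hf : IsBoundedFun f) (x : Fin k → ℝ) :
    |(posOrthant k).indicator f x| ≤ supNorm f := by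
  by_cases hx : x ∈ posOrthant k
  · rw [indicator_of_mem hx]
    exact le_ciSup hf ⟨x, hx⟩
  · rw [indicator_of_notMem hx, abs_zero]
    exact supNorm_nonneg f

lemma IsBoundedFun.bddMeasurable_indicator (hf : IsBoundedFun f) (hfm : Measurable f) :
    BddMeasurable ((posOrthant k).indicator f) :=
  ⟨hfm.indicator (measurableSet_posOrthant k), _, hf.abs_indicator_le_supNorm⟩

end Correlations

namespace IsThermodynamicLimit

variable {ν : Measure ℝ} {Φ : ℕ → ℝ → ℝ} {μ : Measure (ℤ → ℝ)} {k : ℕ}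
  {f g : (Fin k → ℝ) → ℝ} (hμ : IsThermodynamicLimit ν Φ μ)

include hμ

lemma tendsto_correlation (hf : BddMeasurable f) (hg : BddMeasurable g) (n : ℕ) :
    Tendsto (fun V : ℤ × ℤ => correlation (volGibbs ν Φ V.1 V.2) f g n) (atBot ×ˢ atTop)
      (𝓝 (correlation μ f g n)) := by
  let π₁ (x : Fin (n + k) → ℝ) (l : Fin k) : ℝ := x ⟨l, by omega⟩
  let π₂ (x : Fin (n + k) → ℝ) (l : Fin k) : ℝ := x ⟨n + l, by omega⟩
  have hπ₁ : Measurable π₁ := measurable_pi_lambda _ fun l => measurable_pi_apply _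
  have hπ₂ : Measurable π₂ := measurable_pi_lambda _ fun l => measurable_pi_apply _
  have h_left (ω : ℤ → ℝ) : π₁ (window (n + k) 0 ω) = window k 0 ω := rfl
  have h_right (ω : ℤ → ℝ) : π₂ (window (n + k) 0 ω) = window k n ω := by
    ext l
    simp [π₂, window]
  have h_prod := hμ (n + k) 0 _ ((hf.comp hπ₁).mul (hg.comp hπ₂))
  simp only [h_left, h_right] at h_prod
  exact h_prod.sub ((hμ k 0 f hf).mul (hμ k n g hg))

variable [IsProbabilityMeasure ν]

lemma abs_correlation_le (hf : BddMeasurable f) (hg : BddMeasurable g) {b₀ s : ℝ}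
    (hΦ : IsInteraction Φ b₀ s) {K κ : ℝ} {L : ℕ} (hK : CrossBound Φ 0 K)
    (hκ : CrossBound Φ L κ) {n q : ℕ} (hn : k + q * L ≤ n) {F G : ℝ} (hF : ∀ x, |f x| ≤ F)
    (hG : ∀ x, |g x| ≤ G) : |correlation μ f g n| ≤ memoryRate K κ (q + 1) * F * G := by
  refine le_of_tendsto (hμ.tendsto_correlation hf hg n).abs ?_
  filter_upwards [(eventually_le_atBot (0 : ℤ)).prod_mk (eventually_ge_atTop (n : ℤ))] with V hV
  have := hΦ.isProbabilityMeasure_volGibbs ν V.1 V.2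
  have : (k : ℤ) + q * L ≤ n := by exact_mod_cast hn
  have : (n : ℤ) - q * L + q * L = n := by ring
  rw [correlation_eq_covariance hf hg]
  refine abs_covariance_volGibbs_le ν hΦ hK hκ (b := n - q * L) q (by omega) (by omega)
    (hf.comp (continuous_window k 0).measurable) (hg.comp (continuous_window k n).measurable)
    (fun x y hxy => congrArg f ?_) (fun x y hxy => congrArg g ?_) (fun x => hF _) fun x => hG _
  · exact (dependsOn_window k 0).mono (fun i hi => mem_Iio.2 (by have := hi.2; omega)) hxy
  · exact (dependsOn_window k n).mono (fun i hi => mem_Ici.2 (by have := hi.1; omega)) hxy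

lemma ae_pos [IsProbabilityMeasure μ] (hν : ∀ᵐ z ∂ν, 0 < z) : ∀ᵐ ω ∂μ, ∀ j, 0 < ω j := by
  refine ae_all_iff.2 fun j => ?_
  let h : (Fin 1 → ℝ) → ℝ := {x | x 0 ≤ 0}.indicator 1
  have hh : BddMeasurable h :=
    ⟨measurable_one.indicator (measurableSet_le (measurable_pi_apply 0) measurable_const), 1,
      fun x => by by_cases hx : x 0 ≤ 0 <;> simp [h, hx]⟩
  have h_eq_zero (ω : ℤ → ℝ) : h (window 1 j ω) = 0 ↔ 0 < ω j := by
    simp [h, window, indicator_apply]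
  have h_finite (V : ℤ × ℤ) : ∫ ω, h (window 1 j ω) ∂(volGibbs ν Φ V.1 V.2) = 0 := by
    have h_pos : ∀ᵐ ω ∂(Measure.infinitePi fun _ : ℤ => ν), 0 < ω j :=
      (measurePreserving_eval_infinitePi (fun _ : ℤ => ν) j).quasiMeasurePreserving.ae hν
    exact integral_eq_zero_of_ae <|
      (tilted_absolutelyContinuous _ _).ae_le (h_pos.mono fun ω => (h_eq_zero ω).2)
  have h_limit : ∫ ω, h (window 1 j ω) ∂μ = 0 := by
    have := hμ 1 j h hh
    simp only [h_finite] at this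
    exact tendsto_nhds_unique this tendsto_const_nhds
  have h_nonneg (x) : 0 ≤ h x := indicator_nonneg (fun _ _ => zero_le_one) x
  rw [integral_eq_zero_iff_of_nonneg (fun _ => h_nonneg _)
    ((hh.comp (continuous_window 1 j).measurable).integrable μ)] at h_limit
  exact h_limit.mono fun ω => (h_eq_zero ω).1

end IsThermodynamicLimit

section BulkGibbsMeasure

lemma measurable_finWindow (M k i : ℕ) :
    Measurable (finWindow k i : (Fin M → ℝ) → Fin k → ℝ) := by
  refine measurable_pi_lambda _ fun l => ?_
  unfold finWindow
  split_ifs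
  · exact measurable_pi_apply _
  · exact measurable_const

lemma finWindow_window {M k i : ℕ} (h : i + k ≤ M) (ω : ℤ → ℝ) :
    finWindow k i (window M 0 ω) = window k i ω := by
  ext l
  have : i + (l : ℕ) < M := by omega
  simp [finWindow, window, this]

lemma ext_of_map_window_eq {μ μ' : Measure (ℤ → ℝ)} [IsFiniteMeasure μ']
    (h : ∀ k a, μ.map (window k a) = μ'.map (window k a)) : μ = μ' := by
  have h_restrict (I : Finset ℤ) : μ.map I.restrict = μ'.map I.restrict := by
    obtain ⟨N, hN⟩ : ∃ N : ℕ, ∀ i ∈ I, i.natAbs < N :=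
      ⟨I.sup Int.natAbs + 1, fun i hi => Nat.lt_succ_of_le (Finset.le_sup hi)⟩
    let π (x : Fin (2 * N) → ℝ) (i : I) : ℝ :=
      x ⟨((i : ℤ) + N).toNat, by have := hN i i.2; omega⟩
    have hπ : Measurable π := measurable_pi_lambda _ fun i => measurable_pi_apply _
    have hw := (continuous_window (2 * N) (-N)).measurable
    have h_comp : (I.restrict : (ℤ → ℝ) → I → ℝ) = π ∘ window (2 * N) (-N) := by
      ext ω i
      have := hN i i.2
      refine congrArg ω ?_
      dsimp only
      omega
    rw [h_comp, ← Measure.map_map hπ hw, h, Measure.map_map hπ hw]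
  have : ∀ I : Finset ℤ, IsFiniteMeasure (μ'.map (I.restrict : (ℤ → ℝ) → I → ℝ)) :=
    fun _ => inferInstance
  exact IsProjectiveLimit.unique (P := fun I : Finset ℤ => μ'.map I.restrict) h_restrict
    fun _ => rfl

lemma IsBulkGibbsMeasure.unique {v : ℝ → EReal} {m : ℕ∞} {p β : ℝ} {μ μ' : Measure (ℤ → ℝ)}
    (h : IsBulkGibbsMeasure v m p β μ) (h' : IsBulkGibbsMeasure v m p β μ') : μ = μ' := by
  have := h.isProbabilityMeasure
  have := h'.isProbabilityMeasure
  have h_left : Tendsto (fun M : ℕ => M / 2) atTop atTop :=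
    Nat.tendsto_div_const_atTop two_ne_zero
  have h_right : Tendsto (fun M : ℕ => (M : ℤ) - ((M / 2 : ℕ) : ℤ)) atTop atTop :=
    tendsto_atTop_mono (fun M => by simp only [Function.comp_apply]; omega)
      (tendsto_natCast_atTop_atTop.comp h_left)
  refine ext_of_map_window_eq fun k a => ?_
  have hw {P : Measure (ℤ → ℝ)} : AEMeasurable (window k a) P :=
    (continuous_window k a).measurable.aemeasurable
  refine ext_of_forall_integral_eq_of_IsFiniteMeasure fun f => ?_
  have hf {P : Measure (Fin k → ℝ)} : AEStronglyMeasurable f P :=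
    f.continuous.measurable.aestronglyMeasurable
  rw [integral_map hw hf, integral_map hw hf]
  exact tendsto_nhds_unique (h.tendsto k f a _ h_left h_right)
    (h'.tendsto k f a _ h_left h_right)

end BulkGibbsMeasure

section Rate

lemma memoryRate_zero_right (K : ℝ) (q : ℕ) :
    memoryRate K 0 q = (1 - Real.exp (-(4 * K))) ^ q := by
  simp [memoryRate]

lemma memoryRate_le (K : ℝ) {κ κ' : ℝ} (h : κ ≤ κ') (q : ℕ) :
    memoryRate K κ q
      ≤ (1 - Real.exp (-(4 * K))) ^ q + Real.exp (4 * K) * (Real.exp (4 * κ') - 1) := by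
  unfold memoryRate
  gcongr _ + _ * ?_
  linarith [Real.add_one_le_exp (-(4 * κ)), Real.add_one_le_exp (4 * κ')]

lemma natDiv_add_one_rpow_le {s : ℝ} (hs : 2 ≤ s) {n q : ℕ} (hn : 0 < n) (hq : 0 < q) :
    (((n / q : ℕ) : ℝ) + 1) ^ (2 - s) ≤ ((q : ℝ) / n) ^ (s - 2) := by
  have h_le : (n : ℝ) / q ≤ ((n / q : ℕ) : ℝ) + 1 := by
    rw [← Nat.floor_div_eq_div (K := ℝ)]
    exact (Nat.lt_floor_add_one _).le
  calc (((n / q : ℕ) : ℝ) + 1) ^ (2 - s) ≤ ((n : ℝ) / q) ^ (2 - s) :=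
        Real.rpow_le_rpow_of_nonpos (by positivity) h_le (by linarith)
    _ = ((q : ℝ) / n) ^ (s - 2) := by
        rw [← neg_sub, Real.rpow_neg_eq_inv_rpow, inv_div]

end Rate

/-- The bound on the interaction across a particle, per unit of inverse temperature. -/
def cutConst (b rhc s : ℝ) : ℝ := b * rhc ^ (-s) * decayConst s

namespace IsHardCoreDecaying

variable {v : ℝ → EReal} {rhc b s : ℝ} (hv : IsHardCoreDecaying v rhc b s)

include hv

lemma cutConst_pos : 0 < cutConst b rhc s :=
  mul_pos (mul_pos hv.b_pos (Real.rpow_pos_of_pos hv.rhc_pos _)) (decayConst_pos hv.two_lt_s)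

variable {m : ℕ∞} {p β : ℝ}

lemma crossBound_chainInteraction (m : ℕ∞) (hβ : 0 < β) (L : ℕ) :
    CrossBound (chainInteraction v rhc m β) L (cutConst b rhc s * β * ((L : ℝ) + 1) ^ (2 - s)) := by
  convert (hv.isInteraction m hβ).crossBound hv.two_lt_s L using 1
  unfold cutConst
  ring

lemma crossBound_chainInteraction_zero (m : ℕ∞) (hβ : 0 < β) :
    CrossBound (chainInteraction v rhc m β) 0 (cutConst b rhc s * β) := by
  simpa using hv.crossBound_chainInteraction m hβ 0

lemma isBulkGibbsMeasure (hm : 1 ≤ m) (hβ : 0 < β) (hp : 0 < p) {μ : Measure (ℤ → ℝ)}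
    [hμ_prob : IsProbabilityMeasure μ]
    (hμ : IsThermodynamicLimit (siteMeasure v rhc β p) (chainInteraction v rhc m β) μ) :
    IsBulkGibbsMeasure v m p β μ := by
  have := hv.isProbabilityMeasure_siteMeasure hβ hp
  refine ⟨hμ_prob, hμ.ae_pos ((ae_lt_siteMeasure v rhc β p).mono fun _ => hv.rhc_pos.trans),
    fun k f a i hi hi' => ?_⟩
  have hf : BddMeasurable f := ⟨f.continuous.measurable, ‖f‖, fun x => f.norm_coe_le_norm x⟩
  have h_ends : Tendsto (fun M : ℕ => (0 + (a - (i M : ℤ)), (M : ℤ) + (a - i M))) atTop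
      (atBot ×ˢ atTop) := by
    refine .prodMk ?_ ((tendsto_atTop_add_const_right _ a hi').congr fun M => by ring)
    simpa only [zero_add, sub_eq_add_neg, Function.comp_def] using tendsto_atBot_add_const_left _ a
      (tendsto_neg_atTop_atBot.comp (tendsto_natCast_atTop_atTop.comp hi))
  refine ((hμ k a f hf).comp h_ends).congr' ?_
  filter_upwards [hi'.eventually_ge_atTop k] with M hM
  have h_shift := measurePreserving_shift_volGibbs (siteMeasure v rhc β p)
    (hv.isInteraction m hβ) 0 M (a - i M)
  rw [← (hf.comp (measurable_finWindow M k (i M))).integral_comp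
    ((hv.measurePreserving_window_volGibbs hm hβ hp M).comp h_shift)]
  simp only [Function.comp_apply, finWindow_window (by omega : i M + k ≤ M)]
  congr! 3 with ω
  ext l
  exact congrArg ω (by ring)

lemma exists_isThermodynamicLimit_isBulkGibbsMeasure (hm : 1 ≤ m) (hβ : 0 < β) (hp : 0 < p) :
    ∃ μ, IsThermodynamicLimit (siteMeasure v rhc β p) (chainInteraction v rhc m β) μ ∧
      IsBulkGibbsMeasure v m p β μ := by
  have := hv.isProbabilityMeasure_siteMeasure hβ hp
  obtain ⟨μ, _, hμ⟩ :=
    exists_isThermodynamicLimit (siteMeasure v rhc β p) (hv.isInteraction m hβ) hv.two_lt_s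
  exact ⟨μ, hμ, hv.isBulkGibbsMeasure hm hβ hp hμ⟩

lemma existsUnique_isBulkGibbsMeasure (hm : 1 ≤ m) (hβ : 0 < β) (hp : 0 < p) :
    ∃! μ, IsBulkGibbsMeasure v m p β μ := by
  obtain ⟨μ, -, hμ⟩ := hv.exists_isThermodynamicLimit_isBulkGibbsMeasure hm hβ hp
  exact ⟨μ, hμ, fun _ hμ' => hμ'.unique hμ⟩

variable {μ : Measure (ℤ → ℝ)} {k : ℕ} {f g : (Fin k → ℝ) → ℝ}

lemma abs_correlation_le_memoryRate (hm : 1 ≤ m) (hβ : 0 < β) (hp : 0 < p)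
    (hμ : IsBulkGibbsMeasure v m p β μ) (hfm : Measurable f) (hgm : Measurable g)
    (hf : IsBoundedFun f) (hg : IsBoundedFun g) {L : ℕ} {κ : ℝ}
    (hκ : CrossBound (chainInteraction v rhc m β) L κ) {n q : ℕ} (hq : 1 ≤ q)
    (hn : k + (q - 1) * L ≤ n) :
    |correlation μ f g n|
      ≤ memoryRate (cutConst b rhc s * β) κ q * supNorm f * supNorm g := by
  have := hv.isProbabilityMeasure_siteMeasure hβ hp
  obtain ⟨μ', hμ', hμ'_bulk⟩ := hv.exists_isThermodynamicLimit_isBulkGibbsMeasure hm hβ hp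
  obtain rfl := hμ'_bulk.unique hμ
  have h := hμ'.abs_correlation_le (hf.bddMeasurable_indicator hfm)
    (hg.bddMeasurable_indicator hgm) (hv.isInteraction m hβ)
    (hv.crossBound_chainInteraction_zero m hβ) hκ hn hf.abs_indicator_le_supNorm
    hg.abs_indicator_le_supNorm
  rwa [correlation_indicator_posOrthant hμ.ae_pos, Nat.sub_add_cancel hq] at h

lemma abs_correlation_le_of_le_div (hm : 1 ≤ m) (hβ : 0 < β) (hp : 0 < p)
    (hμ : IsBulkGibbsMeasure v m p β μ) (hk : 1 ≤ k) (hfm : Measurable f) (hgm : Measurable g)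
    (hf : IsBoundedFun f) (hg : IsBoundedFun g) {n q : ℕ} (hq : 1 ≤ q)
    (hqn : (q : ℝ) ≤ (n : ℝ) / k) :
    |correlation μ f g n| ≤
      ((1 - Real.exp (-(4 * cutConst b rhc s * β))) ^ q
        + Real.exp (4 * cutConst b rhc s * β) *
          (Real.exp (4 * cutConst b rhc s * β * ((q : ℝ) / n) ^ (s - 2)) - 1))
      * supNorm f * supNorm g := by
  have hqk : q * k ≤ n := by
    rw [le_div_iff₀ (by positivity)] at hqn
    exact_mod_cast hqn
  have hkL : k ≤ n / q := (Nat.le_div_iff_mul_le hq).2 (by linarith)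
  have hn : k + (q - 1) * (n / q) ≤ n := calc
    k + (q - 1) * (n / q) ≤ n / q + (q - 1) * (n / q) := by gcongr
    _ = (q - 1 + 1) * (n / q) := by ring
    _ ≤ n := by
      rw [Nat.sub_add_cancel hq]
      exact Nat.mul_div_le n q
  have h_rate := memoryRate_le (cutConst b rhc s * β) (mul_le_mul_of_nonneg_left
    (natDiv_add_one_rpow_le hv.two_lt_s.le ((Nat.mul_pos hq hk).trans_le hqk) hq)
    (mul_pos hv.cutConst_pos hβ).le) q
  simp only [← mul_assoc] at h_rate
  refine (hv.abs_correlation_le_memoryRate hm hβ hp hμ hfm hgm hf hg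
    (hv.crossBound_chainInteraction m hβ (n / q)) hq hn).trans ?_
  have hF := supNorm_nonneg f
  have hG := supNorm_nonneg g
  gcongr

lemma abs_correlation_le_of_eq_add_one (hβ : 0 < β) (hp : 0 < p)
    (hμ : IsBulkGibbsMeasure v (k + 1 : ℕ) p β μ) (hk : 1 ≤ k) (hfm : Measurable f)
    (hgm : Measurable g) (hf : IsBoundedFun f) (hg : IsBoundedFun g) (n : ℕ) :
    |correlation μ f g n| ≤
      (1 - Real.exp (-(4 * cutConst b rhc s * β))) ^ (n / k) * supNorm f * supNorm g := by
  rcases lt_or_ge n k with hnk | hnk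
  · have := hμ.isProbabilityMeasure
    rw [Nat.div_eq_of_lt hnk, pow_zero, one_mul, ← correlation_indicator_posOrthant hμ.ae_pos]
    exact abs_correlation_le_mul (hf.bddMeasurable_indicator hfm) (hg.bddMeasurable_indicator hgm)
      hf.abs_indicator_le_supNorm hg.abs_indicator_le_supNorm n
  have hκ : CrossBound (chainInteraction v rhc (k + 1 : ℕ) β) k 0 :=
    crossBound_zero_of_forall_eq_zero fun j r hj => if_neg fun h => by
      have : j ≤ k + 1 := by exact_mod_cast h.2
      omega
  have hq : 1 ≤ n / k := (Nat.one_le_div_iff hk).2 hnk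
  have hn : k + (n / k - 1) * k ≤ n := calc
    k + (n / k - 1) * k = (n / k - 1 + 1) * k := by ring
    _ ≤ n := by
      rw [Nat.sub_add_cancel hq]
      exact Nat.div_mul_le_self n k
  have h := hv.abs_correlation_le_memoryRate (by exact_mod_cast Nat.le_add_left 1 k) hβ hp hμ
    hfm hgm hf hg hκ hq hn
  rwa [memoryRate_zero_right, ← mul_assoc] at h

end IsHardCoreDecaying

end LJChain

end

theorem mainTheorem7_general (v : ℝ → EReal) (rhc b s : ℝ)
    (hv : LJChain.IsHardCoreDecaying v rhc b s) (m : ℕ∞) (hm : 1 ≤ m) :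
    ∃ c C : ℝ, 0 < c ∧ 0 < C ∧ ∀ β p : ℝ, 0 < β → 0 < p →
      (∃! μ : MeasureTheory.Measure (ℤ → ℝ), LJChain.IsBulkGibbsMeasure v m p β μ) ∧
      ∀ μ : MeasureTheory.Measure (ℤ → ℝ), LJChain.IsBulkGibbsMeasure v m p β μ →
        ∀ (k : ℕ), 1 ≤ k → ∀ f g : (Fin k → ℝ) → ℝ, Measurable f → Measurable g →
          LJChain.IsBoundedFun f → LJChain.IsBoundedFun g → ∀ n : ℕ,
            (∀ q : ℕ, 1 ≤ q → (q : ℝ) ≤ (n : ℝ) / (k : ℝ) →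
              |LJChain.correlation μ f g n| ≤
                ((1 - Real.exp (-(c * β))) ^ q
                  + Real.exp (c * β) *
                    (Real.exp (C * β * ((q : ℝ) / (n : ℝ)) ^ (s - 2)) - 1))
                * LJChain.supNorm f * LJChain.supNorm g) ∧
            (m = ((k + 1 : ℕ) : ℕ∞) →
              |LJChain.correlation μ f g n| ≤
                (1 - Real.exp (-(c * β))) ^ ⌊(n : ℝ) / (k : ℝ)⌋₊
                * LJChain.supNorm f * LJChain.supNorm g) := by
  have hc : 0 < 4 * LJChain.cutConst b rhc s := mul_pos four_pos hv.cutConst_pos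
  refine ⟨_, _, hc, hc, fun β p hβ hp => ⟨hv.existsUnique_isBulkGibbsMeasure hm hβ hp,
    fun μ hμ k hk f g hfm hgm hf hg n => ⟨fun q hq hqn => ?_, ?_⟩⟩⟩
  · exact hv.abs_correlation_le_of_le_div hm hβ hp hμ hk hfm hgm hf hg hq hqn
  · rintro rfl
    rw [Nat.floor_div_eq_div]
    exact hv.abs_correlation_le_of_eq_add_one hβ hp hμ hk hfm hgm hf hg n

theorem mainTheorem7 (v : ℝ → EReal) (rhc zmin zmax α₁ α₂ s : ℝ)
    (hv : LJChain.IsLennardJonesType v rhc zmin zmax α₁ α₂ s) (hrhc : 0 < rhc)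
    (m : ℕ∞) (hm : 1 ≤ m) :
    ∃ c C : ℝ, 0 < c ∧ 0 < C ∧ ∀ β p : ℝ, 0 < β → 0 < p →
      (∃! μ : MeasureTheory.Measure (ℤ → ℝ), LJChain.IsBulkGibbsMeasure v m p β μ) ∧
      ∀ μ : MeasureTheory.Measure (ℤ → ℝ), LJChain.IsBulkGibbsMeasure v m p β μ →
        ∀ (k : ℕ), 1 ≤ k → ∀ f g : (Fin k → ℝ) → ℝ, Measurable f → Measurable g →
          LJChain.IsBoundedFun f → LJChain.IsBoundedFun g → ∀ n : ℕ,
            (∀ q : ℕ, 1 ≤ q → (q : ℝ) ≤ (n : ℝ) / (k : ℝ) →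
              |LJChain.correlation μ f g n| ≤
                ((1 - Real.exp (-(c * β))) ^ q
                  + Real.exp (c * β) *
                    (Real.exp (C * β * ((q : ℝ) / (n : ℝ)) ^ (s - 2)) - 1))
                * LJChain.supNorm f * LJChain.supNorm g) ∧
            (m = ((k + 1 : ℕ) : ℕ∞) →
              |LJChain.correlation μ f g n| ≤
                (1 - Real.exp (-(c * β))) ^ ⌊(n : ℝ) / (k : ℝ)⌋₊
                * LJChain.supNorm f * LJChain.supNorm g) := by
  obtain ⟨b, hb⟩ := hv.exists_isHardCoreDecaying hrhc
  exact mainTheorem7_general v rhc b s hb m hm
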